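/- For a finite field $\mathbb{F}_q$, let $\mathcal{M}_N$ be the set of monic polynomials of degree $N$ in $\mathbb{F}_q[t]$, and call the monic irreducible polynomials primes. A Steinhaus random multiplicative function $f$ over $\mathbb{F}_q[t]$ is given by independent random variables $f(P)$, indexed by the primes $P$ and uniformly distributed on the unit circle $\{z\in\mathbb{C}:|z|=1\}$, extended to all monic polynomials by $f(1)=1$ and $f(P_1^{a_1}\cdots P_r^{a_r})=f(P_1)^{a_1}\cdots f(P_r)^{a_r}$ for distinct primes $P_1,\dots,P_r$. For each $q$, fix a total order $\prec$ on the primes of $\mathbb{F}_q[t]$ which respects degree, i.e. $P\prec Q$ whenever $\deg P<\deg Q$, and for non-constant monic $F$ let $P^+_\prec(F)$ be the $\prec$-largest prime dividing $F$. Let $\mathcal{A}=\mathcal{A}_{N,q}\subseteq\mathcal{M}_N$ be a family of non-empty sets and $\mathcal{S}=\mathcal{S}_{N,q}\subseteq\mathcal{A}_{N,q}$ a family of subsets. Assume that, as $q^N\to\infty$ (where $q$ and $N$ may vary and depend on each other arbitrarily): (i) $|\mathcal{A}\setminus\mathcal{S}|=o(|\mathcal{A}|)$; (ii) $|\{(F_1,F_2,G_1,G_2)\in\mathcal{S}^4: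 F_1F_2=G_1G_2,\ F_1\neq G_1,\ F_1\neq G_2\}|=o(|\mathcal{A}|^2)$; (iii) $|\{F\in\mathcal{S}: P^+_\prec(F)=Q\}|=o(|\mathcal{A}|)$ uniformly over all primes $Q$ of $\mathbb{F}_q[t]$, i.e. $\max_Q|\{F\in\mathcal{S}: P^+_\prec(F)=Q\}|=o(|\mathcal{A}|)$. If $f$ is a Steinhaus random multiplicative function over $\mathbb{F}_q[t]$, then, as $q^N\to\infty$, $$\frac{1}{\sqrt{|\mathcal{A}|}}\sum_{F\in\mathcal{A}}f(F)\ \xrightarrow{d}\ \mathcal{CN}(0,1),$$ where $\xrightarrow{d}$ is convergence in distribution and $\mathcal{CN}(0,1)$ is the standard complex normal law, whose real and imaginary parts are independent real normal variables of mean $0$ and variance $1/2$. -/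

import Mathlib

open MeasureTheory ProbabilityTheory Filter Polynomial Asymptotics

noncomputable section

/-- The primes of `K[t]`: monic irreducible polynomials. -/
abbrev MonicIrred (K : Type*) [Field K] : Type _ :=
  {P : K[X] // P.Monic ∧ Irreducible P}

/-- The uniform probability measure on the unit circle of `ℂ`: the law of `exp (2πiθ)` for `θ`
uniform on `(0, 1]`. -/
def uniformCircle : Measure ℂ :=
  ((volume : Measure ℝ).restrict (Set.Ioc 0 1)).map
    (fun θ : ℝ => Complex.exp (2 * Real.pi * Complex.I * θ))

/-- The standard complex normal law `CN(0,1)`: independent real and imaginary parts, each of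
law `N(0, 1/2)`. -/
def stdComplexNormal : Measure ℂ :=
  ((gaussianReal 0 (1 / 2)).prod (gaussianReal 0 (1 / 2))).map
    Complex.measurableEquivRealProd.symm

instance isProbabilityMeasure_stdComplexNormal : IsProbabilityMeasure stdComplexNormal :=
  Measure.isProbabilityMeasure_map Complex.measurableEquivRealProd.symm.measurable.aemeasurable

/-- `f` is a Steinhaus random multiplicative function over `K[t]` on the probability space
`(Ω, μ)`: the values at the primes are independent and uniform on the unit circle, and
`f (P₁ ^ a₁ ⋯ Pᵣ ^ aᵣ) = f P₁ ^ a₁ ⋯ f Pᵣ ^ aᵣ` for distinct primes `P₁, …, Pᵣ` (the empty product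
gives `f 1 = 1`). Only the values of `f` at monic polynomials are constrained. -/
structure IsSteinhaus {K : Type*} [Field K] {Ω : Type*} [MeasurableSpace Ω]
    (f : K[X] → Ω → ℂ) (μ : Measure Ω) : Prop where
  measurable_prime : ∀ P : MonicIrred K, Measurable (f P)
  map_prime : ∀ P : MonicIrred K, μ.map (f P) = uniformCircle
  indep_prime : iIndepFun (fun P : MonicIrred K => f P) μ
  apply_prod : ∀ (a : MonicIrred K →₀ ℕ) (ω : Ω),
    f (a.prod fun P n => (P : K[X]) ^ n) ω = a.prod fun P n => f P ω ^ n

/-- `Q` is the largest prime factor of `F` for the strict order `prec` on primes. -/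
def IsLargestPrimeFactor {K : Type*} [Field K] (prec : MonicIrred K → MonicIrred K → Prop)
    (Q : MonicIrred K) (F : K[X]) : Prop :=
  (Q : K[X]) ∣ F ∧ ∀ P : MonicIrred K, (P : K[X]) ∣ F → P = Q ∨ prec P Q

/-- `prec` is a strict total order on the primes which respects degree. -/
structure IsDegreeOrder {K : Type*} [Field K] (prec : MonicIrred K → MonicIrred K → Prop) :
    Prop where
  strictTotal : IsStrictTotalOrder (MonicIrred K) prec
  of_natDegree_lt : ∀ P Q : MonicIrred K,
    (P : K[X]).natDegree < (Q : K[X]).natDegree → prec P Q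

open Classical in
/-- The elements of `S` whose largest prime factor is `Q`. -/
def withLargestPrime {K : Type*} [Field K] (prec : MonicIrred K → MonicIrred K → Prop)
    (S : Finset K[X]) (Q : MonicIrred K) : Finset K[X] :=
  S.filter fun F => IsLargestPrimeFactor prec Q F

open Classical in
/-- The quadruples `(F₁, F₂, G₁, G₂) ∈ S⁴` with `F₁ F₂ = G₁ G₂`, `F₁ ≠ G₁` and `F₁ ≠ G₂`. -/
def offDiagonalSolutions {K : Type*} [Field K] (S : Finset K[X]) :
    Finset (K[X] × K[X] × K[X] × K[X]) :=
  (S ×ˢ S ×ˢ S ×ˢ S).filter fun x =>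
    x.1 * x.2.1 = x.2.2.1 * x.2.2.2 ∧ x.1 ≠ x.2.2.1 ∧ x.1 ≠ x.2.2.2

open Classical in
/-- The set difference `A ∖ S`. -/
def setDifference {K : Type*} [Field K] (A S : Finset K[X]) : Finset K[X] := A \ S

end

/-! Group the sum over `S` by largest prime: let `Z_Q` be the sum of `f F` over those `F` in `S`
whose largest prime is `Q`. Every such `f F` carries a positive power of `f Q`, which averages to
zero independently of the smaller primes. So the `Z_Q`, taken in the order of the primes, are
martingale differences, and so are the real variables `Re (v Z_Q)` for fixed complex `v`. With `v`
the conjugate of `t` over `√|A|`, these give the characteristic function at `t`, and a real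
martingale central limit theorem applies (`exists_norm_charFun_martingale_sub_le`).

That theorem needs the fourth moments to have small sum and the sum of squares to be close in L² to
`|t|²/2`. Since `Re(w)² = (|w|² + Re(w²))/2`, everything reduces to moments of `∑ |Z_Q|²`, `∑ Z_Q²`
and `|Z_Q|⁴`. Orthogonality of the `f F` turns these into counts of `F₁F₂ = G₁G₂` with constraints
on the largest primes. Off-diagonal solutions are negligible by (ii). Diagonal ones are either the
main term `|S|²`, which cancels in the variance, or are at most a constant times the number of pairs
with a common largest prime, which (iii) makes `o(|A|²)`. The part over `A ∖ S` is small in L² by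
(i) and orthogonality.

The resulting bound (`exists_norm_integral_steinhaus_sub_le`) depends on the parameters only through
the three ratios in (i)–(iii). Convergence of characteristic functions therefore holds along the
coarser, countably generated filter defined mainly by those ratios, where Lévy's theorem for
sequences suffices. -/

/-! ### Taylor estimates and the truncated exponential -/

/-- Second order Taylor estimate for `exp (i x)`, valid for all real `x`. -/
lemma norm_cexp_I_sub_one_sub_le (x : ℝ) :
    ‖Complex.exp (Complex.I * x) - 1 - Complex.I * x‖ ≤ 3 * x ^ 2 := by
  have hn : ‖Complex.I * (x : ℂ)‖ = |x| := by simp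
  rcases le_or_gt |x| 1 with hx | hx
  · have h := Complex.norm_exp_sub_sum_le_norm_mul_exp (Complex.I * x) 2
    rw [hn] at h
    have e : Real.exp |x| ≤ 3 :=
      (Real.exp_le_exp.2 hx).trans (by linarith [Real.exp_one_lt_d9])
    have h2 : |x| ^ 2 * Real.exp |x| ≤ 3 * x ^ 2 := by
      rw [sq_abs]; nlinarith [sq_nonneg x]
    simp only [Finset.sum_range_succ, Finset.sum_range_zero] at h
    simp only [pow_zero, Nat.factorial, Nat.cast_one, div_one, zero_add, pow_one, mul_one] at h
    rw [sub_sub]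
    exact h.trans h2
  · have h1 : ‖Complex.exp (Complex.I * x)‖ = 1 := by
      rw [mul_comm]; exact Complex.norm_exp_ofReal_mul_I x
    calc _ ≤ ‖Complex.exp (Complex.I * x)‖ + ‖(1 : ℂ)‖ + ‖Complex.I * (x : ℂ)‖ :=
          (norm_sub_le _ _).trans (by gcongr; exact norm_sub_le _ _)
      _ = 2 + |x| := by rw [h1, hn]; norm_num
      _ ≤ 3 * x ^ 2 := by rw [← sq_abs]; nlinarith

/-- Third order estimate: the quadratic terms of `exp (i x + x² / 2)` cancel. -/
lemma exists_norm_cexp_sub_le_cube (C : ℝ) :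
    ∃ K : ℝ, 0 ≤ K ∧ ∀ x : ℝ, x ^ 2 ≤ C →
      ‖Complex.exp (Complex.I * x + x ^ 2 / 2) - 1 - Complex.I * x‖ ≤ K * |x| ^ 3 := by
  set M := Real.sqrt C
  have hM : 0 ≤ M := Real.sqrt_nonneg C
  -- The first term bounds the exponential remainder, by `|z| ≤ |x| (1 + M/2)`; the other two bound
  -- the leftover cubic and quartic monomials.
  refine ⟨(1 + M / 2) ^ 3 * Real.exp (M * (1 + M / 2)) + 1 / 2 + M / 8, by positivity, ?_⟩
  intro x hx
  have hxM : |x| ≤ M := Real.abs_le_sqrt hx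
  set z : ℂ := Complex.I * x + x ^ 2 / 2 with hz
  have hzn : ‖z‖ ≤ |x| * (1 + M / 2) := by
    calc ‖z‖ ≤ ‖Complex.I * (x : ℂ)‖ + ‖(x : ℂ) ^ 2 / 2‖ := norm_add_le _ _
      _ = |x| + |x| * |x| / 2 := by simp [sq]
      _ ≤ |x| * (1 + M / 2) := by nlinarith [abs_nonneg x]
  have h := Complex.norm_exp_sub_sum_le_norm_mul_exp z 3
  have hR : ‖z‖ ^ 3 * Real.exp ‖z‖ ≤
      (1 + M / 2) ^ 3 * Real.exp (M * (1 + M / 2)) * |x| ^ 3 := by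
    calc ‖z‖ ^ 3 * Real.exp ‖z‖ ≤ (|x| * (1 + M / 2)) ^ 3 * Real.exp (M * (1 + M / 2)) := by
          gcongr
          exact hzn.trans (by gcongr)
      _ = _ := by ring
  -- The `x²/2` in `z` cancels the `-x²/2` coming from `(ix)²/2`, so `1 + z + z²/2` differs from `1
  -- + ix` only by terms of order three and four.
  have hsplit : Complex.exp z - 1 - Complex.I * x =
      (Complex.exp z - ∑ m ∈ Finset.range 3, z ^ m / m.factorial) +
        (Complex.I * x ^ 3 / 2 + x ^ 4 / 8) := by
    simp only [Finset.sum_range_succ, Finset.sum_range_zero, hz]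
    simp only [pow_zero, Nat.factorial]
    push_cast
    ring_nf
    simp only [Complex.I_sq]
    ring
  have hpoly : ‖Complex.I * (x : ℂ) ^ 3 / 2 + (x : ℂ) ^ 4 / 8‖ ≤ (1 / 2 + M / 8) * |x| ^ 3 := by
    calc _ ≤ ‖Complex.I * (x : ℂ) ^ 3 / 2‖ + ‖(x : ℂ) ^ 4 / 8‖ := norm_add_le _ _
      _ = |x| ^ 3 / 2 + |x| ^ 3 * |x| / 8 := by simp; ring
      _ ≤ |x| ^ 3 / 2 + |x| ^ 3 * M / 8 := by gcongr
      _ = _ := by ring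
  rw [hsplit]
  refine (norm_add_le _ _).trans ?_
  calc _ ≤ (1 + M / 2) ^ 3 * Real.exp (M * (1 + M / 2)) * |x| ^ 3 +
        (1 / 2 + M / 8) * |x| ^ 3 := add_le_add (h.trans hR) hpoly
    _ = _ := by ring

/-- The function `exp (q / 2)`, frozen from `q = C` on. -/
noncomputable def truncExp (C q : ℝ) : ℝ := Real.exp (min q C / 2)

lemma truncExp_pos (C q : ℝ) : 0 < truncExp C q := Real.exp_pos _

lemma truncExp_le (C q : ℝ) : truncExp C q ≤ Real.exp (C / 2) :=
  Real.exp_le_exp.2 (by linarith [min_le_right q C])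

lemma continuous_truncExp (C : ℝ) : Continuous (truncExp C) := by
  unfold truncExp; fun_prop

/-- The logarithmic slope is at most `1/2` and the values are at most `exp (C/2)`; the inequality `1
+ y ≤ exp y` replaces differentiation at the kink. The factor `1/2` is dropped. -/
lemma abs_truncExp_sub_le (C p q : ℝ) :
    |truncExp C p - truncExp C q| ≤ Real.exp (C / 2) * |p - q| := by
  wlog h : q ≤ p generalizing p q
  · rw [abs_sub_comm, abs_sub_comm p]; exact this q p (le_of_not_ge h)
  have hm : min q C ≤ min p C := min_le_min_right C h
  have hd : min p C - min q C ≤ p - q := by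
    rcases le_total p C with h1 | h1 <;> rcases le_total q C with h2 | h2 <;>
      simp [h1, h2] <;> linarith
  have hle : truncExp C q ≤ truncExp C p := Real.exp_le_exp.2 (by linarith)
  rw [abs_of_nonneg (sub_nonneg.2 hle), abs_of_nonneg (sub_nonneg.2 h)]
  have h1 : truncExp C q =
      truncExp C p * Real.exp (-((min p C - min q C) / 2)) := by
    unfold truncExp; rw [← Real.exp_add]; congr 1; ring
  have h2 := Real.add_one_le_exp (-((min p C - min q C) / 2))
  have h3 := truncExp_pos C p
  have h4 := truncExp_le C p
  rw [h1]
  nlinarith [mul_le_mul_of_nonneg_right h4 (sub_nonneg.2 h)]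

/-- One step of the telescoping argument of the martingale central limit theorem. -/
lemma exists_norm_truncExp_step_le (C : ℝ) :
    ∃ K : ℝ, 0 ≤ K ∧ ∀ q x : ℝ, 0 ≤ q →
      ‖Complex.exp (Complex.I * x) * (truncExp C (q + x ^ 2) : ℝ) -
          (truncExp C q : ℝ) * (1 + Complex.I * x)‖ ≤
        K * (|x| ^ 3 + if C < q + x ^ 2 then x ^ 2 else 0) := by
  obtain ⟨K, hK, hKx⟩ := exists_norm_cexp_sub_le_cube C
  set E := Real.exp (C / 2)
  have hE : 0 < E := Real.exp_pos _
  refine ⟨E * K + 4 * E, by positivity, fun q x hq => ?_⟩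
  have hx3 : 0 ≤ |x| ^ 3 := by positivity
  -- Past the level `C` the compensation of `x²/2` may fail, and only the Lipschitz bound, of order
  -- `x²`, is available. Below it the ratio of truncated exponentials is exactly `exp (x²/2)`, which
  -- gives order three.
  split_ifs with hc
  · have hsplit : Complex.exp (Complex.I * x) * (truncExp C (q + x ^ 2) : ℝ) -
          (truncExp C q : ℝ) * (1 + Complex.I * x) =
        Complex.exp (Complex.I * x) * ((truncExp C (q + x ^ 2) - truncExp C q : ℝ) : ℂ) +
          (truncExp C q : ℝ) * (Complex.exp (Complex.I * x) - 1 - Complex.I * x) := by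
      push_cast; ring
    have h1 : ‖Complex.exp (Complex.I * x)‖ = 1 := by
      rw [mul_comm]; exact Complex.norm_exp_ofReal_mul_I x
    have h2 := abs_truncExp_sub_le C (q + x ^ 2) q
    rw [add_sub_cancel_left, abs_of_nonneg (sq_nonneg x)] at h2
    have h3 := norm_cexp_I_sub_one_sub_le x
    rw [hsplit]
    calc _ ≤ E * x ^ 2 + E * (3 * x ^ 2) := by
          refine (norm_add_le _ _).trans (add_le_add ?_ ?_)
          · rw [norm_mul, h1, one_mul, Complex.norm_real, Real.norm_eq_abs]; exact h2
          · rw [norm_mul, Complex.norm_real, Real.norm_eq_abs, abs_of_pos (truncExp_pos _ _)]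
            exact mul_le_mul (truncExp_le C q) h3 (norm_nonneg _) hE.le
      _ = 4 * E * x ^ 2 := by ring
      _ ≤ (E * K + 4 * E) * (|x| ^ 3 + x ^ 2) := by
          have := mul_nonneg hE.le hK
          nlinarith [sq_nonneg x, mul_nonneg this hx3, mul_nonneg hE.le hx3,
            mul_nonneg this (sq_nonneg x)]
  · have hc' : q + x ^ 2 ≤ C := not_lt.1 hc
    have hqC : q ≤ C := by nlinarith [sq_nonneg x]
    have hsplit : Complex.exp (Complex.I * x) * (truncExp C (q + x ^ 2) : ℝ) -
          (truncExp C q : ℝ) * (1 + Complex.I * x) =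
        (truncExp C q : ℝ) * (Complex.exp (Complex.I * x + x ^ 2 / 2) - 1 - Complex.I * x) := by
      have : truncExp C (q + x ^ 2) = truncExp C q * Real.exp (x ^ 2 / 2) := by
        unfold truncExp
        rw [min_eq_left hc', min_eq_left hqC, ← Real.exp_add]; congr 1; ring
      rw [this, Complex.exp_add]
      push_cast
      ring
    rw [hsplit, norm_mul, Complex.norm_real, Real.norm_eq_abs, abs_of_pos (truncExp_pos _ _),
      add_zero]
    calc _ ≤ E * (K * |x| ^ 3) :=
          mul_le_mul (truncExp_le C q) (hKx x (by linarith)) (norm_nonneg _) hE.le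
      _ ≤ _ := by nlinarith [mul_nonneg hE.le hx3]

/-! ### Quantitative martingale central limit theorem -/

section Martingale

universe u v

/-- Telescoping estimate for `E[exp (i ∑ X) h (∑ X²)]` along bounded martingale differences `X`. -/
lemma exists_norm_integral_truncExp_sub_one_le (C : ℝ) (hC : 0 ≤ C) :
    ∃ K : ℝ, 0 ≤ K ∧ ∀ {Ω : Type u} [MeasurableSpace Ω] (μ : Measure Ω) [IsProbabilityMeasure μ]
      {κ : Type v} [LinearOrder κ] (X : κ → Ω → ℝ) (B : ℝ),
      (∀ p, Measurable (X p)) → (∀ p, ∀ᵐ ω ∂μ, |X p ω| ≤ B) →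
      (∀ (p : κ) (s : Finset κ), (∀ r ∈ s, r < p) → ∀ g : ℝ → ℝ → ℂ,
        Continuous (Function.uncurry g) → (∃ M, ∀ a b, ‖g a b‖ ≤ M) →
        ∫ ω, (X p ω : ℂ) * g (∑ r ∈ s, X r ω) (∑ r ∈ s, X r ω ^ 2) ∂μ = 0) →
      ∀ s : Finset κ,
        ‖∫ ω, Complex.exp (Complex.I * (∑ r ∈ s, X r ω : ℝ)) *
            (truncExp C (∑ r ∈ s, X r ω ^ 2) : ℝ) ∂μ - 1‖ ≤
          K * (∑ r ∈ s, ∫ ω, |X r ω| ^ 3 ∂μ +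
            ∫ ω, (if C < ∑ r ∈ s, X r ω ^ 2 then ∑ r ∈ s, X r ω ^ 2 else 0) ∂μ) := by
  obtain ⟨K, hK, hstep⟩ := exists_norm_truncExp_step_le C
  refine ⟨K, hK, ?_⟩
  intro Ω _ μ _ κ _ X B hm hB hmart s
  have hpow : ∀ p (n : ℕ), Integrable (fun ω => |X p ω| ^ n) μ := fun p n => by
    refine Integrable.of_bound ((hm p).abs.pow_const n).aestronglyMeasurable (B ^ n) ?_
    filter_upwards [hB p] with ω hω
    rw [Real.norm_eq_abs, abs_pow, abs_abs]
    gcongr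
  have hsq : ∀ p, Integrable (fun ω => X p ω ^ 2) μ := fun p => by
    simpa only [sq_abs] using hpow p 2
  have hSm : ∀ s : Finset κ, Measurable (fun ω => ∑ r ∈ s, X r ω) := fun s =>
    Finset.measurable_fun_sum s fun r _ => hm r
  have hQm : ∀ s : Finset κ, Measurable (fun ω => ∑ r ∈ s, X r ω ^ 2) := fun s =>
    Finset.measurable_fun_sum s fun r _ => (hm r).pow_const 2
  have hQi : ∀ s : Finset κ, Integrable (fun ω => ∑ r ∈ s, X r ω ^ 2) μ := fun s =>
    integrable_finsetSum s fun r _ => hsq r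
  have hite : ∀ (s : Finset κ) (Y : Ω → ℝ), Integrable Y μ →
      Integrable (fun ω => if C < ∑ r ∈ s, X r ω ^ 2 then Y ω else 0) μ := fun s Y hY => by
    have := hY.indicator (measurableSet_lt (measurable_const (a := C)) (hQm s))
    refine this.congr (Eventually.of_forall fun ω => ?_)
    simp [Set.indicator_apply]
  have hnorm : ∀ x : ℝ, ‖Complex.exp (Complex.I * x)‖ = 1 := fun x => by
    rw [mul_comm]; exact Complex.norm_exp_ofReal_mul_I x
  have hei : ∀ s : Finset κ, Integrable (fun ω => Complex.exp (Complex.I * (∑ r ∈ s, X r ω : ℝ)) *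
      (truncExp C (∑ r ∈ s, X r ω ^ 2) : ℝ)) μ := fun s => by
    refine Integrable.of_bound ?_ (Real.exp (C / 2)) (Eventually.of_forall fun ω => ?_)
    · have h1 := hSm s
      have h2 := (continuous_truncExp C).measurable.comp (hQm s)
      refine Measurable.aestronglyMeasurable (Measurable.mul (by fun_prop) ?_)
      exact Complex.measurable_ofReal.comp h2
    · rw [norm_mul, hnorm, one_mul, Complex.norm_real, Real.norm_eq_abs,
        abs_of_pos (truncExp_pos _ _)]
      exact truncExp_le _ _
  -- Indices are added in increasing order, so the new one lies above all earlier ones, as the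
  -- martingale hypothesis demands.
  induction s using Finset.induction_on_max with
  | empty => simp [truncExp, hC, not_lt.2 hC]
  | insert p s hlt ih =>
    have hp : p ∉ s := fun h => lt_irrefl _ (hlt p h)
    have hxe : Integrable (fun ω => (X p ω : ℂ) *
        (Complex.exp (Complex.I * (∑ r ∈ s, X r ω : ℝ)) *
          (truncExp C (∑ r ∈ s, X r ω ^ 2) : ℝ))) μ := by
      refine Integrable.bdd_mul (c := B) (hei s)
        (Complex.measurable_ofReal.comp (hm p)).aestronglyMeasurable ?_
      filter_upwards [hB p] with ω hω
      simpa using hω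
    have hzero : ∫ ω, (X p ω : ℂ) * (Complex.exp (Complex.I * (∑ r ∈ s, X r ω : ℝ)) *
          (truncExp C (∑ r ∈ s, X r ω ^ 2) : ℝ)) ∂μ = 0 := by
      refine hmart p s hlt (fun a b => Complex.exp (Complex.I * a) * (truncExp C b : ℝ)) ?_ ?_
      · have := continuous_truncExp C
        simp only [Function.uncurry_def]
        fun_prop
      · refine ⟨Real.exp (C / 2), fun a b => ?_⟩
        rw [norm_mul, hnorm, one_mul, Complex.norm_real, Real.norm_eq_abs,
          abs_of_pos (truncExp_pos _ _)]
        exact truncExp_le _ _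
    have hdiff : ‖∫ ω, Complex.exp (Complex.I * (∑ r ∈ insert p s, X r ω : ℝ)) *
            (truncExp C (∑ r ∈ insert p s, X r ω ^ 2) : ℝ) ∂μ -
          ∫ ω, Complex.exp (Complex.I * (∑ r ∈ s, X r ω : ℝ)) *
            (truncExp C (∑ r ∈ s, X r ω ^ 2) : ℝ) ∂μ‖ ≤
        ∫ ω, K * (|X p ω| ^ 3 +
          if C < ∑ r ∈ insert p s, X r ω ^ 2 then X p ω ^ 2 else 0) ∂μ := by
      -- The linear term `i X p` times the earlier factor has mean zero, so it can be subtracted for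
      -- free; what remains is the one-step error.
      have e1 : ∫ ω, Complex.exp (Complex.I * (∑ r ∈ insert p s, X r ω : ℝ)) *
            (truncExp C (∑ r ∈ insert p s, X r ω ^ 2) : ℝ) ∂μ -
          ∫ ω, Complex.exp (Complex.I * (∑ r ∈ s, X r ω : ℝ)) *
            (truncExp C (∑ r ∈ s, X r ω ^ 2) : ℝ) ∂μ =
          ∫ ω, (Complex.exp (Complex.I * (∑ r ∈ insert p s, X r ω : ℝ)) *
            (truncExp C (∑ r ∈ insert p s, X r ω ^ 2) : ℝ) -
           Complex.exp (Complex.I * (∑ r ∈ s, X r ω : ℝ)) *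
            (truncExp C (∑ r ∈ s, X r ω ^ 2) : ℝ) - Complex.I * ((X p ω : ℂ) *
              (Complex.exp (Complex.I * (∑ r ∈ s, X r ω : ℝ)) *
                (truncExp C (∑ r ∈ s, X r ω ^ 2) : ℝ)))) ∂μ := by
        have e := integral_sub ((hei (insert p s)).sub (hei s)) (hxe.const_mul Complex.I)
        simp only [Pi.sub_apply] at e
        rw [e, integral_sub (hei _) (hei _), integral_const_mul, hzero, mul_zero, sub_zero]
      rw [e1]
      refine norm_integral_le_of_norm_le ((hpow p 3).add (hite _ _ (hsq p)) |>.const_mul K)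
        (Eventually.of_forall fun ω => ?_)
      have h := hstep (∑ r ∈ s, X r ω ^ 2) (X p ω) (Finset.sum_nonneg fun r _ => sq_nonneg _)
      have e2 : ∑ r ∈ insert p s, X r ω ^ 2 = ∑ r ∈ s, X r ω ^ 2 + X p ω ^ 2 := by
        rw [Finset.sum_insert hp, add_comm]
      rw [e2, Finset.sum_insert hp]
      refine le_trans (le_of_eq ?_) h
      rw [← one_mul ‖Complex.exp (Complex.I * (X p ω : ℂ)) * _ - _‖, ← hnorm (∑ r ∈ s, X r ω),
        ← norm_mul]
      congr 1
      push_cast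
      rw [mul_add, Complex.exp_add]
      ring
    have hint : ∫ ω, K * (|X p ω| ^ 3 +
          if C < ∑ r ∈ insert p s, X r ω ^ 2 then X p ω ^ 2 else 0) ∂μ =
        K * (∫ ω, |X p ω| ^ 3 ∂μ +
          ∫ ω, (if C < ∑ r ∈ insert p s, X r ω ^ 2 then X p ω ^ 2 else 0) ∂μ) := by
      rw [integral_const_mul, integral_add (hpow p 3) (hite _ _ (hsq p))]
    -- Partial sums of squares only grow: once `C` is exceeded it stays exceeded, so the error terms
    -- accumulate inside a single tail integral.
    have hmono : ∫ ω, (if C < ∑ r ∈ s, X r ω ^ 2 then ∑ r ∈ s, X r ω ^ 2 else 0) ∂μ +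
          ∫ ω, (if C < ∑ r ∈ insert p s, X r ω ^ 2 then X p ω ^ 2 else 0) ∂μ ≤
        ∫ ω, (if C < ∑ r ∈ insert p s, X r ω ^ 2 then ∑ r ∈ insert p s, X r ω ^ 2 else 0) ∂μ := by
      rw [← integral_add (hite _ _ (hQi s)) (hite _ _ (hsq p))]
      refine integral_mono ((hite _ _ (hQi s)).add (hite _ _ (hsq p))) (hite _ _ (hQi _))
        fun ω => ?_
      have e2 : ∑ r ∈ insert p s, X r ω ^ 2 = ∑ r ∈ s, X r ω ^ 2 + X p ω ^ 2 := by
        rw [Finset.sum_insert hp, add_comm]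
      have hq : 0 ≤ ∑ r ∈ s, X r ω ^ 2 := Finset.sum_nonneg fun r _ => sq_nonneg _
      have hx := sq_nonneg (X p ω)
      simp only [e2]
      split_ifs <;> linarith
    rw [Finset.sum_insert hp]
    calc _ ≤ _ := norm_sub_le_norm_sub_add_norm_sub _ (∫ ω, Complex.exp (Complex.I *
              (∑ r ∈ s, X r ω : ℝ)) * (truncExp C (∑ r ∈ s, X r ω ^ 2) : ℝ) ∂μ) _
      _ ≤ _ := add_le_add (hdiff.trans hint.le) ih
      _ = K * (∫ ω, |X p ω| ^ 3 ∂μ + ∑ r ∈ s, ∫ ω, |X r ω| ^ 3 ∂μ +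
          (∫ ω, (if C < ∑ r ∈ s, X r ω ^ 2 then ∑ r ∈ s, X r ω ^ 2 else 0) ∂μ +
          ∫ ω, (if C < ∑ r ∈ insert p s, X r ω ^ 2 then X p ω ^ 2 else 0) ∂μ)) := by ring
      _ ≤ _ := by gcongr

/-- If `E (Y - c)² ≤ δ²` then `E |Y - c| ≤ δ`. -/
lemma integral_abs_le_of_integral_sq_le {Ω : Type u} [MeasurableSpace Ω] (μ : Measure Ω)
    [IsProbabilityMeasure μ] {Y : Ω → ℝ} {δ : ℝ} (hδ : 0 < δ) (hY : Integrable Y μ)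
    (hY2 : Integrable (fun ω => Y ω ^ 2) μ) (h : ∫ ω, Y ω ^ 2 ∂μ ≤ δ ^ 2) :
    ∫ ω, |Y ω| ∂μ ≤ δ := by
  -- Pointwise `|Y| ≤ Y²/(2δ) + δ/2`, from `(|Y| - δ)² ≥ 0`.
  have h1 : ∫ ω, |Y ω| ∂μ ≤ ∫ ω, ((2 * δ)⁻¹ * Y ω ^ 2 + δ / 2) ∂μ := by
    refine integral_mono hY.abs ((hY2.const_mul _).add (integrable_const _)) fun ω => ?_
    have : |Y ω| - ((2 * δ)⁻¹ * Y ω ^ 2 + δ / 2) = -((2 * δ)⁻¹ * (|Y ω| - δ) ^ 2) := by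
      rw [sub_sq, sq_abs]; field_simp; ring
    have h2 : 0 ≤ (2 * δ)⁻¹ * (|Y ω| - δ) ^ 2 := by positivity
    simp only; linarith
  rw [integral_add (hY2.const_mul _) (integrable_const _), integral_const_mul] at h1
  simp only [integral_const, probReal_univ, smul_eq_mul, one_mul] at h1
  have h2 : (2 * δ)⁻¹ * ∫ ω, Y ω ^ 2 ∂μ ≤ (2 * δ)⁻¹ * δ ^ 2 := by gcongr
  have h3 : (2 * δ)⁻¹ * δ ^ 2 = δ / 2 := by field_simp
  linarith

/-- Quantitative martingale central limit theorem for characteristic functions: if the sum of the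
squares is close to `v` in `L²` and the sum of the fourth moments is small, then `∑ X` is close to
`N(0, v)`. -/
theorem exists_norm_charFun_martingale_sub_le (v : ℝ) (hv : 0 ≤ v) :
    ∃ K : ℝ, 0 ≤ K ∧ ∀ {Ω : Type u} [MeasurableSpace Ω] (μ : Measure Ω) [IsProbabilityMeasure μ]
      {κ : Type v} [LinearOrder κ] (X : κ → Ω → ℝ) (B : ℝ),
      (∀ p, Measurable (X p)) → (∀ p, ∀ᵐ ω ∂μ, |X p ω| ≤ B) →
      (∀ (p : κ) (s : Finset κ), (∀ r ∈ s, r < p) → ∀ g : ℝ → ℝ → ℂ,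
        Continuous (Function.uncurry g) → (∃ M, ∀ a b, ‖g a b‖ ≤ M) →
        ∫ ω, (X p ω : ℂ) * g (∑ r ∈ s, X r ω) (∑ r ∈ s, X r ω ^ 2) ∂μ = 0) →
      ∀ (s : Finset κ) (δ : ℝ), 0 < δ → δ ≤ 1 →
        ∑ r ∈ s, ∫ ω, X r ω ^ 4 ∂μ ≤ δ ^ 2 →
        ∫ ω, (∑ r ∈ s, X r ω ^ 2 - v) ^ 2 ∂μ ≤ δ ^ 2 →
        ‖∫ ω, Complex.exp (Complex.I * (∑ r ∈ s, X r ω : ℝ)) ∂μ - Real.exp (-(v / 2))‖ ≤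
          K * δ := by
  -- The truncation level `v + 1` leaves a margin of one above the limiting variance: the truncation
  -- is inactive at `v`, and the tail forces `Q - v > 1`.
  obtain ⟨K, hK, hmain⟩ := exists_norm_integral_truncExp_sub_one_le.{u, v} (v + 1) (by linarith)
  set E := Real.exp ((v + 1) / 2)
  have hE : 0 < E := Real.exp_pos _
  have hE1 : Real.exp (-(v / 2)) ≤ 1 := Real.exp_le_one_iff.2 (by linarith)
  have hE0 := Real.exp_pos (-(v / 2))
  -- `E` pays for replacing `Q` by `v` inside the truncated exponential; `2v + 3` adds `v + 2` from
  -- the cubes and `v + 1` from the tail.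
  refine ⟨E + K * (2 * v + 3), by positivity, ?_⟩
  intro Ω _ μ _ κ _ X B hm hB hmart s δ hδ hδ1 h4 h2
  have hpow : ∀ p (n : ℕ), Integrable (fun ω => |X p ω| ^ n) μ := fun p n => by
    refine Integrable.of_bound ((hm p).abs.pow_const n).aestronglyMeasurable (B ^ n) ?_
    filter_upwards [hB p] with ω hω
    rw [Real.norm_eq_abs, abs_pow, abs_abs]
    gcongr
  have hsq : ∀ p, Integrable (fun ω => X p ω ^ 2) μ := fun p => by
    simpa only [sq_abs] using hpow p 2
  have hfour : ∀ p, Integrable (fun ω => X p ω ^ 4) μ := fun p => by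
    refine (hpow p 4).congr (Eventually.of_forall fun ω => ?_)
    exact Even.pow_abs (by decide) _
  set Q : Ω → ℝ := fun ω => ∑ r ∈ s, X r ω ^ 2 with hQdef
  have hSm : Measurable (fun ω => ∑ r ∈ s, X r ω) :=
    Finset.measurable_fun_sum s fun r _ => hm r
  have hQm : Measurable Q := Finset.measurable_fun_sum s fun r _ => (hm r).pow_const 2
  have hQi : Integrable Q μ := integrable_finsetSum s fun r _ => hsq r
  have hQ0 : ∀ ω, 0 ≤ Q ω := fun ω => Finset.sum_nonneg fun r _ => sq_nonneg _
  have hQb : ∀ᵐ ω ∂μ, Q ω ≤ s.card * B ^ 2 := by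
    have : ∀ᵐ ω ∂μ, ∀ r ∈ s, |X r ω| ≤ B := (ae_ball_iff s.countable_toSet).2 fun r _ => hB r
    filter_upwards [this] with ω hω
    rw [← nsmul_eq_mul]
    refine Finset.sum_le_card_nsmul _ _ _ fun r hr => ?_
    rw [← sq_abs]
    gcongr
    exact hω r hr
  have hQv : Integrable (fun ω => Q ω - v) μ := hQi.sub (integrable_const v)
  have hQv2 : Integrable (fun ω => (Q ω - v) ^ 2) μ := by
    refine Integrable.of_bound ((hQm.sub_const v).pow_const 2).aestronglyMeasurable
      ((s.card * B ^ 2 + v) ^ 2) ?_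
    filter_upwards [hQb] with ω hω
    rw [Real.norm_eq_abs, abs_of_nonneg (sq_nonneg _)]
    exact sq_le_sq' (by linarith [hQ0 ω]) (by linarith)
  have hQabs : ∫ ω, |Q ω - v| ∂μ ≤ δ := integral_abs_le_of_integral_sq_le μ hδ hQv hQv2 h2
  have hEQ : ∫ ω, Q ω ∂μ ≤ v + δ := by
    have : ∫ ω, Q ω ∂μ ≤ ∫ ω, (v + |Q ω - v|) ∂μ :=
      integral_mono hQi ((integrable_const v).add hQv.abs) fun ω => by
        linarith [le_abs_self (Q ω - v)]
    rw [integral_add (integrable_const v) hQv.abs] at this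
    simp only [integral_const, probReal_univ, smul_eq_mul, one_mul] at this
    linarith
  have hcube : ∑ r ∈ s, ∫ ω, |X r ω| ^ 3 ∂μ ≤ (v + 2) * δ := by
    -- Third moments are interpolated between second and fourth: `|x|³ ≤ δ x² + x⁴/δ`.
    have h1 : ∀ r ∈ s, ∫ ω, |X r ω| ^ 3 ∂μ ≤ δ * ∫ ω, X r ω ^ 2 ∂μ + δ⁻¹ * ∫ ω, X r ω ^ 4 ∂μ := by
      intro r _
      rw [← integral_const_mul, ← integral_const_mul,
        ← integral_add ((hsq r).const_mul _) ((hfour r).const_mul _)]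
      refine integral_mono (hpow r 3) (((hsq r).const_mul _).add ((hfour r).const_mul _))
        fun ω => ?_
      have e : δ * X r ω ^ 2 + δ⁻¹ * X r ω ^ 4 - |X r ω| ^ 3 =
          δ⁻¹ * |X r ω| ^ 2 * ((δ - |X r ω|) ^ 2 + δ * |X r ω|) := by
        rw [← sq_abs (X r ω), ← Even.pow_abs (by decide : Even 4) (X r ω)]
        field_simp
        ring
      have : 0 ≤ δ⁻¹ * |X r ω| ^ 2 * ((δ - |X r ω|) ^ 2 + δ * |X r ω|) := by positivity
      simp only; linarith
    calc _ ≤ ∑ r ∈ s, (δ * ∫ ω, X r ω ^ 2 ∂μ + δ⁻¹ * ∫ ω, X r ω ^ 4 ∂μ) := Finset.sum_le_sum h1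
      _ = δ * ∫ ω, Q ω ∂μ + δ⁻¹ * ∑ r ∈ s, ∫ ω, X r ω ^ 4 ∂μ := by
        rw [Finset.sum_add_distrib, ← Finset.mul_sum, ← Finset.mul_sum,
          integral_finsetSum s fun r _ => hsq r]
      _ ≤ δ * (v + δ) + δ⁻¹ * δ ^ 2 := by gcongr
      _ = δ * (v + δ) + δ := by field_simp
      _ ≤ (v + 2) * δ := by nlinarith
  -- When `Q - v > 1`, one has `Q ≤ (v + 1)(Q - v)²`.
  have htail : ∫ ω, (if v + 1 < Q ω then Q ω else 0) ∂μ ≤ (v + 1) * δ := by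
    calc _ ≤ ∫ ω, (v + 1) * (Q ω - v) ^ 2 ∂μ := by
          refine integral_mono_of_nonneg (Eventually.of_forall fun ω => ?_) (hQv2.const_mul _)
            (Eventually.of_forall fun ω => ?_)
          · simp only [Pi.zero_apply]; split_ifs
            · exact hQ0 ω
            · exact le_rfl
          · simp only; split_ifs with h
            · have : 1 < Q ω - v := by linarith
              nlinarith [mul_nonneg hv (sub_nonneg.2 this.le)]
            · positivity
      _ = (v + 1) * ∫ ω, (Q ω - v) ^ 2 ∂μ := integral_const_mul _ _
      _ ≤ (v + 1) * δ ^ 2 := by gcongr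
      _ ≤ (v + 1) * δ := by gcongr; nlinarith
  have hone := hmain μ X B hm hB hmart s
  have hnorm : ∀ x : ℝ, ‖Complex.exp (Complex.I * x)‖ = 1 := fun x => by
    rw [mul_comm]; exact Complex.norm_exp_ofReal_mul_I x
  have hhv : truncExp (v + 1) v * Real.exp (-(v / 2)) = 1 := by
    unfold truncExp
    rw [min_eq_left (by linarith), ← Real.exp_add]; simp
  have hmeas1 : Measurable (fun ω => Complex.exp (Complex.I * (∑ r ∈ s, X r ω : ℝ))) := by
    fun_prop
  have hmeas2 : Measurable (fun ω => ((truncExp (v + 1) (Q ω) : ℝ) : ℂ)) :=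
    Complex.measurable_ofReal.comp ((continuous_truncExp (v + 1)).measurable.comp hQm)
  have hi1 : Integrable (fun ω => Complex.exp (Complex.I * (∑ r ∈ s, X r ω : ℝ))) μ :=
    Integrable.of_bound hmeas1.aestronglyMeasurable 1 (Eventually.of_forall fun ω => (hnorm _).le)
  have hi2 : Integrable (fun ω => Complex.exp (Complex.I * (∑ r ∈ s, X r ω : ℝ)) *
      (truncExp (v + 1) (Q ω) : ℝ)) μ := by
    refine Integrable.of_bound (hmeas1.mul hmeas2).aestronglyMeasurable E
      (Eventually.of_forall fun ω => ?_)
    rw [norm_mul, hnorm, one_mul, Complex.norm_real, Real.norm_eq_abs,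
      abs_of_pos (truncExp_pos _ _)]
    exact truncExp_le _ _
  have hfirst : ‖∫ ω, Complex.exp (Complex.I * (∑ r ∈ s, X r ω : ℝ)) ∂μ -
      Real.exp (-(v / 2)) * ∫ ω, Complex.exp (Complex.I * (∑ r ∈ s, X r ω : ℝ)) *
        (truncExp (v + 1) (Q ω) : ℝ) ∂μ‖ ≤ E * δ := by
    rw [← integral_const_mul, ← integral_sub hi1 (hi2.const_mul _)]
    calc _ ≤ ∫ ω, E * |Q ω - v| ∂μ := by
          refine norm_integral_le_of_norm_le (hQv.abs.const_mul _) (Eventually.of_forall fun ω => ?_)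
          have e : Complex.exp (Complex.I * (∑ r ∈ s, X r ω : ℝ)) - (Real.exp (-(v / 2)) : ℝ) *
                (Complex.exp (Complex.I * (∑ r ∈ s, X r ω : ℝ)) * (truncExp (v + 1) (Q ω) : ℝ)) =
              Complex.exp (Complex.I * (∑ r ∈ s, X r ω : ℝ)) *
                ((Real.exp (-(v / 2)) * (truncExp (v + 1) v - truncExp (v + 1) (Q ω)) : ℝ) : ℂ) := by
            rw [mul_sub, mul_comm (Real.exp _) (truncExp (v + 1) v), hhv]
            push_cast
            ring
          rw [e, norm_mul, hnorm, one_mul, Complex.norm_real, Real.norm_eq_abs, abs_mul,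
            abs_of_pos hE0]
          have := abs_truncExp_sub_le (v + 1) v (Q ω)
          rw [abs_sub_comm v] at this
          calc _ ≤ 1 * (E * |Q ω - v|) := by gcongr
            _ = _ := one_mul _
      _ = E * ∫ ω, |Q ω - v| ∂μ := integral_const_mul _ _
      _ ≤ E * δ := by gcongr
  have hsecond : ‖(Real.exp (-(v / 2)) : ℂ) *
      ∫ ω, Complex.exp (Complex.I * (∑ r ∈ s, X r ω : ℝ)) *
        (truncExp (v + 1) (Q ω) : ℝ) ∂μ - Real.exp (-(v / 2))‖ ≤ K * (2 * v + 3) * δ := by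
    have e : ∀ z : ℂ, (Real.exp (-(v / 2)) : ℂ) * z - Real.exp (-(v / 2)) =
        (Real.exp (-(v / 2)) : ℝ) * (z - 1) := fun z => by ring
    rw [e, norm_mul, Complex.norm_real, Real.norm_eq_abs, abs_of_pos hE0]
    calc _ ≤ 1 * (K * ((v + 2) * δ + (v + 1) * δ)) := by
          refine mul_le_mul hE1 (hone.trans ?_) (norm_nonneg _) zero_le_one
          gcongr
      _ = _ := by ring
  calc _ ≤ _ := norm_sub_le_norm_sub_add_norm_sub _ _ _
    _ ≤ E * δ + K * (2 * v + 3) * δ := add_le_add hfirst hsecond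
    _ = _ := by ring

end Martingale

/-! ### Moments of the uniform law on the circle -/

section Circle

lemma norm_eq_one_ae_uniformCircle : ∀ᵐ z ∂uniformCircle, ‖z‖ = 1 := by
  unfold uniformCircle
  rw [ae_map_iff (by fun_prop) (measurableSet_eq_fun (by fun_prop) (by fun_prop))]
  refine Eventually.of_forall fun θ => ?_
  rw [show 2 * (Real.pi : ℂ) * Complex.I * θ = ((2 * Real.pi * θ : ℝ) : ℂ) * Complex.I by
    push_cast; ring]
  exact Complex.norm_exp_ofReal_mul_I _

/-- The integrand is the nontrivial character `exp (2πi(m - n)θ)`, integrated over a full period. -/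
lemma integral_pow_mul_conj_pow_uniformCircle {m n : ℕ} (h : m ≠ n) :
    ∫ z, z ^ m * (starRingEnd ℂ z) ^ n ∂uniformCircle = 0 := by
  unfold uniformCircle
  rw [integral_map (by fun_prop) (by fun_prop)]
  have hc : 2 * (Real.pi : ℂ) * Complex.I * ((m : ℂ) - n) ≠ 0 :=
    mul_ne_zero Complex.two_pi_I_ne_zero (sub_ne_zero.2 (by exact_mod_cast h))
  have e : ∀ θ : ℝ, Complex.exp (2 * Real.pi * Complex.I * θ) ^ m *
      (starRingEnd ℂ (Complex.exp (2 * Real.pi * Complex.I * θ))) ^ n =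
      Complex.exp (2 * (Real.pi : ℂ) * Complex.I * ((m : ℂ) - n) * θ) := by
    intro θ
    rw [← Complex.exp_conj, ← Complex.exp_nat_mul, ← Complex.exp_nat_mul, ← Complex.exp_add]
    congr 1
    simp only [map_mul, Complex.conj_I, Complex.conj_ofReal, map_ofNat]
    ring
  simp_rw [e]
  rw [← intervalIntegral.integral_of_le zero_le_one, integral_exp_mul_complex hc]
  have h1 : Complex.exp (2 * (Real.pi : ℂ) * Complex.I * ((m : ℂ) - n) * (1 : ℝ)) = 1 := by
    have := Complex.exp_int_mul_two_pi_mul_I ((m : ℤ) - n)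
    push_cast at this
    rw [← this]
    congr 1
    push_cast
    ring
  rw [h1]
  simp

end Circle

/-! ### Monic polynomials as exponent vectors -/

section Factorization

variable {K : Type*} [Field K]

/-- The monic polynomial with prescribed exponents at the primes. -/
noncomputable def ofExponents (a : MonicIrred K →₀ ℕ) : K[X] := a.prod fun P n => (P : K[X]) ^ n

lemma ofExponents_add (a b : MonicIrred K →₀ ℕ) :
    ofExponents (a + b) = ofExponents a * ofExponents b :=
  Finsupp.prod_add_index' (fun _ => pow_zero _) fun _ _ _ => pow_add _ _ _

/-- Splitting off monic irreducible factors lowers the degree. This makes the defining product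
formula of a Steinhaus function usable at every monic polynomial. -/
lemma Polynomial.Monic.exists_ofExponents {F : K[X]} (hF : F.Monic) :
    ∃ a : MonicIrred K →₀ ℕ, ofExponents a = F := by
  induction hn : F.natDegree using Nat.strong_induction_on generalizing F with
  | _ n ih =>
    rcases Nat.eq_zero_or_pos n with h0 | hpos
    · refine ⟨0, ?_⟩
      rw [hF.natDegree_eq_zero.1 (hn.trans h0)]
      simp [ofExponents]
    · obtain ⟨P, hPm, hPi, G, hG⟩ := exists_monic_irreducible_factor F
        (not_isUnit_of_natDegree_pos F (hn ▸ hpos))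
      have hGm : G.Monic := hPm.of_mul_monic_left (hG ▸ hF)
      have hdeg : F.natDegree = P.natDegree + G.natDegree := by
        rw [hG, hPm.natDegree_mul hGm]
      have hPd := hPi.natDegree_pos
      obtain ⟨a, ha⟩ := ih G.natDegree (by omega) hGm rfl
      refine ⟨Finsupp.single ⟨P, hPm, hPi⟩ 1 + a, ?_⟩
      rw [ofExponents_add, ha, hG]
      simp [ofExponents]

lemma MonicIrred.eq_of_dvd {P Q : MonicIrred K} (h : (P : K[X]) ∣ Q) : P = Q :=
  Subtype.ext <| eq_of_monic_of_associated P.2.1 Q.2.1 (P.2.2.associated_of_dvd Q.2.2 h)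

lemma dvd_ofExponents_iff {Q : MonicIrred K} {a : MonicIrred K →₀ ℕ} :
    (Q : K[X]) ∣ ofExponents a ↔ a Q ≠ 0 := by
  constructor
  · intro h hQ
    obtain ⟨P, hP, hd⟩ := (Q.2.2.prime.dvd_finsetProd_iff _).1 h
    have := MonicIrred.eq_of_dvd (Q.2.2.prime.dvd_of_dvd_pow hd)
    subst this
    exact Finsupp.mem_support_iff.1 hP hQ
  · intro h
    exact (dvd_pow_self _ h).trans (Finset.dvd_prod_of_mem _ (Finsupp.mem_support_iff.2 h))

end Factorization

/-! ### Independence and orthogonality of Steinhaus values -/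

section Steinhaus

variable {K : Type*} [Field K] {Ω : Type*} {f : K[X] → Ω → ℂ}

/-- The `σ`-algebra generated by the values of `f` at the primes other than `Q`. -/
noncomputable abbrev sigmaAway (f : K[X] → Ω → ℂ) (Q : MonicIrred K) : MeasurableSpace Ω :=
  ⨆ P ∈ ({Q}ᶜ : Set (MonicIrred K)), MeasurableSpace.comap (f P) inferInstance

lemma measurable_finsupp_prod {m : MeasurableSpace Ω} (a : MonicIrred K →₀ ℕ)
    (h : ∀ P : MonicIrred K, a P ≠ 0 → Measurable (f P)) :
    Measurable fun ω => a.prod fun P n => f P ω ^ n := by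
  unfold Finsupp.prod
  exact Finset.measurable_fun_prod _ fun P hP => (h P (Finsupp.mem_support_iff.1 hP)).pow_const _

lemma measurable_sigmaAway_prime {P Q : MonicIrred K} (h : P ≠ Q) :
    Measurable[sigmaAway f Q] (f P) :=
  Measurable.of_comap_le (le_iSup₂_of_le P h le_rfl)

lemma measurable_sigmaAway_erase (a : MonicIrred K →₀ ℕ) (Q : MonicIrred K) :
    Measurable[sigmaAway f Q] fun ω => (a.erase Q).prod fun P n => f P ω ^ n :=
  measurable_finsupp_prod _ fun P hP => measurable_sigmaAway_prime (by
    rintro rfl; simp at hP)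

namespace IsSteinhaus

variable [mΩ : MeasurableSpace Ω] {μ : Measure Ω}

lemma apply_ofExponents (hf : IsSteinhaus f μ) (a : MonicIrred K →₀ ℕ) (ω : Ω) :
    f (ofExponents a) ω = a.prod fun P n => f P ω ^ n := hf.apply_prod a ω

lemma measurable (hf : IsSteinhaus f μ) {F : K[X]} (hF : F.Monic) : Measurable (f F) := by
  obtain ⟨a, rfl⟩ := hF.exists_ofExponents
  simp_rw [funext (hf.apply_ofExponents a)]
  exact measurable_finsupp_prod a fun P _ => hf.measurable_prime P

lemma measurable_sigmaAway (hf : IsSteinhaus f μ) {F : K[X]} (hF : F.Monic)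
    {Q : MonicIrred K} (hQ : ¬ (Q : K[X]) ∣ F) :
    Measurable[sigmaAway f Q] (f F) := by
  obtain ⟨a, rfl⟩ := hF.exists_ofExponents
  simp_rw [funext (hf.apply_ofExponents a)]
  rw [dvd_ofExponents_iff, not_not] at hQ
  exact measurable_finsupp_prod a fun P hP => measurable_sigmaAway_prime (by rintro rfl; exact hP hQ)

lemma sigmaAway_le (hf : IsSteinhaus f μ) (Q : MonicIrred K) : sigmaAway f Q ≤ mΩ :=
  iSup₂_le fun P _ => (hf.measurable_prime P).comap_le

lemma norm_ae (hf : IsSteinhaus f μ) {F : K[X]} (hF : F.Monic) : ∀ᵐ ω ∂μ, ‖f F ω‖ = 1 := by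
  obtain ⟨a, rfl⟩ := hF.exists_ofExponents
  have hp : ∀ P : MonicIrred K, ∀ᵐ ω ∂μ, ‖f P ω‖ = 1 := fun P => by
    have := norm_eq_one_ae_uniformCircle
    rw [← hf.map_prime P] at this
    exact ae_of_ae_map (hf.measurable_prime P).aemeasurable this
  have : ∀ᵐ ω ∂μ, ∀ P ∈ a.support, ‖f P ω‖ = 1 :=
    (ae_ball_iff a.support.countable_toSet).2 fun P _ => hp P
  filter_upwards [this] with ω hω
  rw [hf.apply_ofExponents, Finsupp.prod, norm_prod]
  exact Finset.prod_eq_one fun P hP => by rw [norm_pow, hω P hP, one_pow]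

lemma apply_mul (hf : IsSteinhaus f μ) {F G : K[X]} (hF : F.Monic) (hG : G.Monic) (ω : Ω) :
    f (F * G) ω = f F ω * f G ω := by
  obtain ⟨a, rfl⟩ := hF.exists_ofExponents
  obtain ⟨b, rfl⟩ := hG.exists_ofExponents
  rw [← ofExponents_add]
  simp only [hf.apply_ofExponents]
  exact Finsupp.prod_add_index' (fun _ => pow_zero _) fun _ _ _ => pow_add _ _ _

/-- Distinct powers of `f Q` and their conjugates average to zero against functions of the other
primes. -/
lemma integral_pow_mul_conj_pow_mul (hf : IsSteinhaus f μ) {Q : MonicIrred K} {m n : ℕ} (h : m ≠ n)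
    {Y : Ω → ℂ}
    (hY : Measurable[sigmaAway f Q] Y) :
    ∫ ω, f Q ω ^ m * (starRingEnd ℂ (f Q ω)) ^ n * Y ω ∂μ = 0 := by
  have hYm : Measurable Y := hY.mono (hf.sigmaAway_le Q) le_rfl
  have hQm := hf.measurable_prime Q
  have hind : IndepFun (f Q) Y μ := by
    rw [IndepFun_iff_Indep]
    -- The index sets `{Q}` and its complement are disjoint, so they generate independent
    -- σ-algebras.
    have hi := indep_iSup_of_disjoint (fun P : MonicIrred K => (hf.measurable_prime P).comap_le)
      ((iIndepFun_iff_iIndep _ _ _).1 hf.indep_prime)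
      (disjoint_compl_right : Disjoint ({Q} : Set (MonicIrred K)) {Q}ᶜ)
    refine indep_of_indep_of_le_left (indep_of_indep_of_le_right hi hY.comap_le) ?_
    exact le_iSup₂_of_le Q rfl le_rfl
  have hφ : Measurable fun z : ℂ => z ^ m * (starRingEnd ℂ z) ^ n := by fun_prop
  have := (hind.comp hφ measurable_id).integral_fun_mul_eq_mul_integral
    (hφ.comp hQm).aestronglyMeasurable hYm.aestronglyMeasurable
  simp only [Function.comp_apply, id_eq] at this
  rw [this]
  have h0 := integral_pow_mul_conj_pow_uniformCircle h
  rw [← hf.map_prime Q, integral_map hQm.aemeasurable hφ.aestronglyMeasurable] at h0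
  rw [h0, zero_mul]

lemma apply_eq_pow_mul (hf : IsSteinhaus f μ) {a : MonicIrred K →₀ ℕ} (Q : MonicIrred K) (ω : Ω) :
    f (ofExponents a) ω = f Q ω ^ a Q * (a.erase Q).prod fun P n => f P ω ^ n := by
  rw [hf.apply_ofExponents]
  exact (Finsupp.mul_prod_erase' a Q _ fun _ => pow_zero _).symm

/-- `f F` is a positive power of `f Q` times a function of the other primes; the power has mean zero
and is independent of the rest. This is the source of the martingale property. -/
lemma integral_mul_eq_zero (hf : IsSteinhaus f μ) {F : K[X]} (hF : F.Monic)
    {Q : MonicIrred K} (hQ : (Q : K[X]) ∣ F)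
    {Y : Ω → ℂ} (hY : Measurable[sigmaAway f Q] Y) : ∫ ω, f F ω * Y ω ∂μ = 0 := by
  obtain ⟨a, rfl⟩ := hF.exists_ofExponents
  rw [dvd_ofExponents_iff] at hQ
  have := hf.integral_pow_mul_conj_pow_mul hQ (measurable_sigmaAway_erase (f := f) a Q |>.mul hY)
  rw [← this]
  refine integral_congr_ae (Eventually.of_forall fun ω => ?_)
  simp only [hf.apply_eq_pow_mul Q ω, Pi.mul_apply]
  ring

lemma integral_conj_mul_eq_zero (hf : IsSteinhaus f μ) {F : K[X]} (hF : F.Monic) {Q : MonicIrred K}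
    (hQ : (Q : K[X]) ∣ F) {Y : Ω → ℂ} (hY : Measurable[sigmaAway f Q] Y) :
    ∫ ω, starRingEnd ℂ (f F ω) * Y ω ∂μ = 0 := by
  have h := hf.integral_mul_eq_zero hF hQ (Y := fun ω => starRingEnd ℂ (Y ω))
    ((by fun_prop : Measurable (starRingEnd ℂ)).comp hY)
  have h2 := congrArg (starRingEnd ℂ) h
  rw [← integral_conj, map_zero] at h2
  simpa using h2

variable [IsProbabilityMeasure μ]

/-- Orthonormality of the characters `f F`: distinct monic polynomials differ in the exponent of
some prime, and averaging over that prime alone already gives zero. -/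
lemma integral_mul_conj (hf : IsSteinhaus f μ) {F G : K[X]} (hF : F.Monic) (hG : G.Monic)
    [Decidable (F = G)] :
    ∫ ω, f F ω * starRingEnd ℂ (f G ω) ∂μ = if F = G then 1 else 0 := by
  split_ifs with h
  · subst h
    have : (fun ω => f F ω * starRingEnd ℂ (f F ω)) =ᵐ[μ] fun _ => 1 := by
      filter_upwards [hf.norm_ae hF] with ω hω
      rw [Complex.mul_conj, Complex.normSq_eq_norm_sq, hω]; simp
    rw [integral_congr_ae this]; simp
  · obtain ⟨a, rfl⟩ := hF.exists_ofExponents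
    obtain ⟨b, rfl⟩ := hG.exists_ofExponents
    obtain ⟨Q, hQ⟩ : ∃ Q, a Q ≠ b Q := by
      by_contra! hab; exact h (by rw [Finsupp.ext hab])
    have h0 := hf.integral_pow_mul_conj_pow_mul hQ ((measurable_sigmaAway_erase (f := f) a Q).mul
      ((by fun_prop : Measurable (starRingEnd ℂ)).comp (measurable_sigmaAway_erase (f := f) b Q)))
    rw [← h0]
    refine integral_congr_ae (Eventually.of_forall fun ω => ?_)
    simp only [hf.apply_eq_pow_mul Q ω, Pi.mul_apply, Function.comp_apply, map_mul, map_pow]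
    ring

end IsSteinhaus

end Steinhaus

/-! ### Second moments as solution counts -/

section Moments

variable {K : Type*} [Field K] {Ω : Type*} [MeasurableSpace Ω] {f : K[X] → Ω → ℂ}
  {μ : Measure Ω}

lemma ae_norm_sum_le (hf : IsSteinhaus f μ) {D : Finset K[X]} (hD : ∀ F ∈ D, F.Monic) :
    ∀ᵐ ω ∂μ, ‖∑ F ∈ D, f F ω‖ ≤ D.card := by
  have : ∀ᵐ ω ∂μ, ∀ F ∈ D, ‖f F ω‖ = 1 :=
    (ae_ball_iff D.countable_toSet).2 fun F hF => hf.norm_ae (hD F hF)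
  filter_upwards [this] with ω hω
  refine (norm_sum_le _ _).trans ?_
  rw [Finset.sum_congr rfl hω]; simp

lemma measurable_sum_apply (hf : IsSteinhaus f μ) {D : Finset K[X]} (hD : ∀ F ∈ D, F.Monic) :
    Measurable fun ω => ∑ F ∈ D, f F ω :=
  Finset.measurable_fun_sum D fun F hF => hf.measurable (hD F hF)

lemma apply_one (hf : IsSteinhaus f μ) (ω : Ω) : f 1 ω = 1 := by
  simpa using hf.apply_prod 0 ω

variable [IsProbabilityMeasure μ]

open Classical in
/-- Second moments of sums of `f H * conj (f G)` count the solutions of an equation. -/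
lemma integral_norm_sq_sum (hf : IsSteinhaus f μ) {α : Type*} (J : Finset α)
    (H G : α → K[X]) (hH : ∀ j ∈ J, (H j).Monic) (hG : ∀ j ∈ J, (G j).Monic) :
    ∫ ω, ‖∑ j ∈ J, f (H j) ω * starRingEnd ℂ (f (G j) ω)‖ ^ 2 ∂μ =
      ((J ×ˢ J).filter fun x => H x.1 * G x.2 = H x.2 * G x.1).card := by
  have hcomplex : ((∫ ω, ‖∑ j ∈ J, f (H j) ω * starRingEnd ℂ (f (G j) ω)‖ ^ 2 ∂μ : ℝ) : ℂ) =
      ∑ x ∈ J ×ˢ J, if H x.1 * G x.2 = H x.2 * G x.1 then 1 else 0 := by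
    rw [← integral_complex_ofReal]
    have e : ∀ ω, ((‖∑ j ∈ J, f (H j) ω * starRingEnd ℂ (f (G j) ω)‖ ^ 2 : ℝ) : ℂ) =
        ∑ x ∈ J ×ˢ J, f (H x.1 * G x.2) ω * starRingEnd ℂ (f (H x.2 * G x.1) ω) := by
      intro ω
      rw [← Complex.normSq_eq_norm_sq, ← Complex.mul_conj, map_sum, Finset.sum_mul_sum,
        ← Finset.sum_product']
      refine Finset.sum_congr rfl fun x hx => ?_
      obtain ⟨h1, h2⟩ := Finset.mem_product.1 hx
      rw [hf.apply_mul (hH _ h1) (hG _ h2), hf.apply_mul (hH _ h2) (hG _ h1)]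
      simp only [map_mul, Complex.conj_conj]
      ring
    simp_rw [e]
    rw [integral_finsetSum]
    · refine Finset.sum_congr rfl fun x hx => ?_
      obtain ⟨h1, h2⟩ := Finset.mem_product.1 hx
      exact hf.integral_mul_conj ((hH _ h1).mul (hG _ h2)) ((hH _ h2).mul (hG _ h1))
    · intro x hx
      obtain ⟨h1, h2⟩ := Finset.mem_product.1 hx
      have m1 := hf.measurable ((hH _ h1).mul (hG _ h2))
      have m2 := hf.measurable ((hH _ h2).mul (hG _ h1))
      refine Integrable.of_bound (by fun_prop) 1 ?_
      filter_upwards [hf.norm_ae ((hH _ h1).mul (hG _ h2)),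
        hf.norm_ae ((hH _ h2).mul (hG _ h1))] with ω w1 w2
      rw [norm_mul, RCLike.norm_conj, w1, w2, one_mul]
  rw [Finset.sum_boole] at hcomplex
  exact_mod_cast hcomplex

open Classical in
lemma integral_norm_sq_sum_mul (hf : IsSteinhaus f μ) (J : Finset (K[X] × K[X]))
    (h₁ : ∀ x ∈ J, x.1.Monic) (h₂ : ∀ x ∈ J, x.2.Monic) :
    ∫ ω, ‖∑ x ∈ J, f x.1 ω * f x.2 ω‖ ^ 2 ∂μ =
      ((J ×ˢ J).filter fun x => x.1.1 * x.1.2 = x.2.1 * x.2.2).card := by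
  have hm : ∀ x ∈ J, (x.1 * x.2).Monic := fun x hx => Monic.mul (h₁ x hx) (h₂ x hx)
  have h := integral_norm_sq_sum hf J (fun x => x.1 * x.2) (fun _ => 1) hm fun _ _ => monic_one
  have e : ∀ ω, ∑ x ∈ J, f x.1 ω * f x.2 ω =
      ∑ x ∈ J, f (x.1 * x.2) ω * starRingEnd ℂ (f 1 ω) := fun ω => by
    refine Finset.sum_congr rfl fun x hx => ?_
    rw [hf.apply_mul (h₁ x hx) (h₂ x hx), apply_one hf, map_one, mul_one]
  simp_rw [e]
  rw [h]
  congr 2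
  refine Finset.filter_congr fun x _ => ?_
  rw [mul_one, mul_one]

lemma integral_norm_sq_sum_apply (hf : IsSteinhaus f μ) {D : Finset K[X]}
    (hD : ∀ F ∈ D, F.Monic) : ∫ ω, ‖∑ F ∈ D, f F ω‖ ^ 2 ∂μ = D.card := by
  classical
  have := integral_norm_sq_sum hf D (fun F => F) (fun _ => 1) hD fun _ _ => monic_one
  simp only [apply_one hf, map_one, mul_one] at this
  rw [this, ← Finset.diag_card D]
  congr 2
  ext x
  simp only [Finset.mem_filter, Finset.mem_product, Finset.mem_diag]
  constructor
  · rintro ⟨⟨h1, -⟩, h⟩; exact ⟨h1, h⟩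
  · rintro ⟨h1, h⟩; exact ⟨⟨h1, h ▸ h1⟩, h⟩

end Moments

/-! ### Counting solutions within fibers -/

section Counting

variable {K : Type*} [Field K] {κ : Type*}

open Classical in
/-- The pairs of elements of `S` with the same value of `c`. -/
noncomputable def sameFiber (S : Finset K[X]) (c : K[X] → κ) : Finset (K[X] × K[X]) :=
  (S ×ˢ S).filter fun x => c x.1 = c x.2

lemma mem_sameFiber {S : Finset K[X]} {c : K[X] → κ} {x : K[X] × K[X]} :
    x ∈ sameFiber S c ↔ (x.1 ∈ S ∧ x.2 ∈ S) ∧ c x.1 = c x.2 := by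
  simp [sameFiber]

lemma mem_offDiagonalSolutions {S : Finset K[X]} {x : K[X] × K[X] × K[X] × K[X]} :
    x ∈ offDiagonalSolutions S ↔ (x.1 ∈ S ∧ x.2.1 ∈ S ∧ x.2.2.1 ∈ S ∧ x.2.2.2 ∈ S) ∧
      x.1 * x.2.1 = x.2.2.1 * x.2.2.2 ∧ x.1 ≠ x.2.2.1 ∧ x.1 ≠ x.2.2.2 := by
  simp [offDiagonalSolutions]

open Classical in
lemma card_sameFiber_le (S : Finset K[X]) (c : K[X] → κ) {m : ℝ}
    (hm : ∀ k, ((S.filter fun F => c F = k).card : ℝ) ≤ m) :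
    ((sameFiber S c).card : ℝ) ≤ S.card * m := by
  have h : (sameFiber S c).card = ∑ F ∈ S, (S.filter fun G => c G = c F).card := by
    rw [sameFiber, Finset.card_filter, Finset.sum_product]
    refine Finset.sum_congr rfl fun F _ => ?_
    rw [Finset.card_filter]
    simp only [eq_comm]
  rw [h, Nat.cast_sum, ← nsmul_eq_mul]
  exact Finset.sum_le_card_nsmul _ _ _ fun F _ => hm (c F)

-- Cancelling a nonzero factor shows that a solution is either off-diagonal or has `(G₁, G₂)` equal
-- to `(F₁, F₂)` up to order; each of the two orders contributes at most one solution per fiber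
-- pair.
open Classical in
lemma card_mul_eq_mul_le (S : Finset K[X]) (hS : ∀ F ∈ S, F ≠ 0) (c : K[X] → κ) :
    ((sameFiber S c ×ˢ sameFiber S c).filter fun x => x.1.1 * x.1.2 = x.2.1 * x.2.2).card ≤
      2 * (sameFiber S c).card + (offDiagonalSolutions S).card := by
  have hsub : ((sameFiber S c ×ˢ sameFiber S c).filter fun x => x.1.1 * x.1.2 = x.2.1 * x.2.2) ⊆
      ((sameFiber S c).image fun y => (y, y)) ∪ ((sameFiber S c).image fun y => (y, y.swap)) ∪
        (offDiagonalSolutions S).image fun z => ((z.1, z.2.1), (z.2.2.1, z.2.2.2)) := by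
    rintro ⟨⟨F₁, F₂⟩, ⟨G₁, G₂⟩⟩ hx
    simp only [Finset.mem_filter, Finset.mem_product] at hx
    obtain ⟨⟨h1, h2⟩, he⟩ := hx
    have m1 := mem_sameFiber.1 h1
    have m2 := mem_sameFiber.1 h2
    simp only at m1 m2
    have hne := hS F₁ m1.1.1
    simp only [Finset.mem_union, Finset.mem_image]
    by_cases e1 : F₁ = G₁
    · subst e1
      have : F₂ = G₂ := mul_left_cancel₀ hne he
      subst this
      exact Or.inl (Or.inl ⟨_, h1, rfl⟩)
    · by_cases e2 : F₁ = G₂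
      · subst e2
        have : F₂ = G₁ := mul_left_cancel₀ hne (by rw [he, mul_comm])
        subst this
        exact Or.inl (Or.inr ⟨_, h1, rfl⟩)
      · exact Or.inr ⟨(F₁, F₂, G₁, G₂), mem_offDiagonalSolutions.2
          ⟨⟨m1.1.1, m1.1.2, m2.1.1, m2.1.2⟩, he, e1, e2⟩, rfl⟩
  refine (Finset.card_le_card hsub).trans ((Finset.card_union_le _ _).trans ?_)
  refine add_le_add ((Finset.card_union_le _ _).trans ?_) Finset.card_image_le
  rw [two_mul]
  exact add_le_add Finset.card_image_le Finset.card_image_le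

-- Here the pairs are `(F₁, G₁)` and `(F₂, G₂)`, with `F₁G₂ = F₂G₁`. The case `F₁ = G₁`, `F₂ = G₂`
-- involves no fiber constraint and gives the main term; its coefficient one is what lets the
-- variance cancel. The case `F₁ = F₂`, `G₁ = G₂` costs one fiber pair.
open Classical in
lemma card_mul_eq_mul_le_sq (S : Finset K[X]) (hS : ∀ F ∈ S, F ≠ 0) (c : K[X] → κ) :
    ((sameFiber S c ×ˢ sameFiber S c).filter fun x => x.1.1 * x.2.2 = x.2.1 * x.1.2).card ≤
      S.card ^ 2 + (sameFiber S c).card + (offDiagonalSolutions S).card := by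
  have hsub : ((sameFiber S c ×ˢ sameFiber S c).filter fun x => x.1.1 * x.2.2 = x.2.1 * x.1.2) ⊆
      ((S ×ˢ S).image fun y => ((y.1, y.1), (y.2, y.2))) ∪
        ((sameFiber S c).image fun y => (y, y)) ∪
        (offDiagonalSolutions S).image fun z => ((z.1, z.2.2.2), (z.2.2.1, z.2.1)) := by
    rintro ⟨⟨F₁, G₁⟩, ⟨F₂, G₂⟩⟩ hx
    simp only [Finset.mem_filter, Finset.mem_product] at hx
    obtain ⟨⟨h1, h2⟩, he⟩ := hx
    have m1 := mem_sameFiber.1 h1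
    have m2 := mem_sameFiber.1 h2
    simp only at m1 m2
    have hne := hS F₁ m1.1.1
    simp only [Finset.mem_union, Finset.mem_image]
    by_cases e1 : F₁ = G₁
    · subst e1
      have : G₂ = F₂ := mul_left_cancel₀ hne (by rw [he, mul_comm])
      subst this
      exact Or.inl (Or.inl ⟨(F₁, G₂), Finset.mem_product.2 ⟨m1.1.1, m2.1.1⟩, rfl⟩)
    · by_cases e2 : F₁ = F₂
      · subst e2
        have : G₂ = G₁ := mul_left_cancel₀ hne he
        subst this
        exact Or.inl (Or.inr ⟨_, h1, rfl⟩)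
      · exact Or.inr ⟨(F₁, G₂, F₂, G₁), mem_offDiagonalSolutions.2
          ⟨⟨m1.1.1, m2.1.2, m2.1.1, m1.1.2⟩, he, e2, e1⟩, rfl⟩
  refine (Finset.card_le_card hsub).trans ((Finset.card_union_le _ _).trans ?_)
  refine add_le_add ((Finset.card_union_le _ _).trans ?_) Finset.card_image_le
  refine add_le_add (Finset.card_image_le.trans ?_) Finset.card_image_le
  rw [Finset.card_product, sq]

end Counting

/-! ### Moments of the fiber sums -/

section FiberMoments

variable {K : Type*} [Field K] {Ω : Type*} {κ : Type*}

open Classical in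
/-- The sum of `f` over the elements of `S` with `c F = k`. -/
noncomputable def fiberSum (f : K[X] → Ω → ℂ) (S : Finset K[X]) (c : K[X] → κ) (k : κ) (ω : Ω) : ℂ :=
  ∑ F ∈ S.filter (fun F => c F = k), f F ω

variable {f : K[X] → Ω → ℂ}

open Classical in
lemma sum_fiberSum (S : Finset K[X]) (c : K[X] → κ) (ω : Ω) :
    ∑ k ∈ S.image c, fiberSum f S c k ω = ∑ F ∈ S, f F ω :=
  Finset.sum_fiberwise_of_maps_to (fun _ hF => Finset.mem_image_of_mem c hF) _

-- Expanding each product of sums over a fiber yields a sum over pairs in a common fiber, the shape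
-- required by the second-moment counts.
open Classical in
lemma sum_fiberSum_bilinear (S : Finset K[X]) (c : K[X] → κ) (g : K[X] → ℂ) (ω : Ω) :
    ∑ k ∈ S.image c, fiberSum f S c k ω * ∑ F ∈ S.filter (fun F => c F = k), g F =
      ∑ x ∈ sameFiber S c, f x.1 ω * g x.2 := by
  have h : ∀ x ∈ sameFiber S c, c x.1 ∈ S.image c := fun x hx =>
    Finset.mem_image_of_mem c (mem_sameFiber.1 hx).1.1
  rw [← Finset.sum_fiberwise_of_maps_to h]
  refine Finset.sum_congr rfl fun k _ => ?_
  rw [fiberSum, Finset.sum_mul_sum, ← Finset.sum_product']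
  refine Finset.sum_congr ?_ fun _ _ => rfl
  ext x
  simp only [Finset.mem_product, Finset.mem_filter, mem_sameFiber]
  constructor
  · rintro ⟨⟨h1, h2⟩, h3, h4⟩; exact ⟨⟨⟨h1, h3⟩, h2.trans h4.symm⟩, h2⟩
  · rintro ⟨⟨⟨h1, h3⟩, h2⟩, h4⟩; exact ⟨⟨h1, h4⟩, h3, h2 ▸ h4⟩

variable [MeasurableSpace Ω] {μ : Measure Ω}

open Classical in
lemma measurable_fiberSum (hf : IsSteinhaus f μ) {S : Finset K[X]} (hS : ∀ F ∈ S, F.Monic)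
    (c : K[X] → κ) (k : κ) : Measurable (fiberSum f S c k) :=
  measurable_sum_apply hf fun F hF => hS F (Finset.mem_filter.1 hF).1

open Classical in
lemma ae_norm_fiberSum_le (hf : IsSteinhaus f μ) {S : Finset K[X]} (hS : ∀ F ∈ S, F.Monic)
    (c : K[X] → κ) (k : κ) : ∀ᵐ ω ∂μ, ‖fiberSum f S c k ω‖ ≤ S.card := by
  filter_upwards [ae_norm_sum_le hf (D := S.filter fun F => c F = k)
    fun F hF => hS F (Finset.mem_filter.1 hF).1] with ω hω
  exact hω.trans (Nat.cast_le.2 (Finset.card_filter_le _ _))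

variable [IsProbabilityMeasure μ]

open Classical in
lemma integral_norm_sq_sum_fiberSum_sq_le (hf : IsSteinhaus f μ) {S : Finset K[X]}
    (hS : ∀ F ∈ S, F.Monic) (c : K[X] → κ) :
    ∫ ω, ‖∑ k ∈ S.image c, fiberSum f S c k ω ^ 2‖ ^ 2 ∂μ ≤
      2 * (sameFiber S c).card + (offDiagonalSolutions S).card := by
  have e : ∀ ω, ∑ k ∈ S.image c, fiberSum f S c k ω ^ 2 =
      ∑ x ∈ sameFiber S c, f x.1 ω * f x.2 ω := fun ω => by
    rw [← sum_fiberSum_bilinear (f := f) S c (fun F => f F ω) ω]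
    exact Finset.sum_congr rfl fun k _ => sq _
  simp_rw [e]
  rw [integral_norm_sq_sum_mul hf _ (fun x hx => hS _ (mem_sameFiber.1 hx).1.1)
    fun x hx => hS _ (mem_sameFiber.1 hx).1.2]
  exact_mod_cast card_mul_eq_mul_le S (fun F hF => (hS F hF).ne_zero) c

-- The fourth moment at `k` counts solutions lying wholly in the fiber of `k`. These sets are
-- disjoint as `k` varies, so their total is still bounded by the count over all fiber pairs.
open Classical in
lemma sum_integral_norm_fiberSum_pow_four_le (hf : IsSteinhaus f μ) {S : Finset K[X]}
    (hS : ∀ F ∈ S, F.Monic) (c : K[X] → κ) :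
    ∑ k ∈ S.image c, ∫ ω, ‖fiberSum f S c k ω‖ ^ 4 ∂μ ≤
      2 * (sameFiber S c).card + (offDiagonalSolutions S).card := by
  set D := (sameFiber S c ×ˢ sameFiber S c).filter fun x => x.1.1 * x.1.2 = x.2.1 * x.2.2
  have hk : ∀ k ∈ S.image c, ∫ ω, ‖fiberSum f S c k ω‖ ^ 4 ∂μ ≤
      (D.filter fun x => c x.1.1 = k).card := by
    intro k _
    set T := S.filter fun F => c F = k
    have hT : ∀ F ∈ T, F.Monic := fun F hF => hS F (Finset.mem_filter.1 hF).1
    have e : ∀ ω, ‖fiberSum f S c k ω‖ ^ 4 = ‖∑ x ∈ T ×ˢ T, f x.1 ω * f x.2 ω‖ ^ 2 := fun ω => by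
      have : ∑ x ∈ T ×ˢ T, f x.1 ω * f x.2 ω = fiberSum f S c k ω ^ 2 := by
        rw [sq, fiberSum, Finset.sum_mul_sum, ← Finset.sum_product']
      rw [this, norm_pow, ← pow_mul]
    simp_rw [e]
    rw [integral_norm_sq_sum_mul hf _ (fun x hx => hT _ (Finset.mem_product.1 hx).1)
      fun x hx => hT _ (Finset.mem_product.1 hx).2]
    refine Nat.cast_le.2 (Finset.card_le_card fun x hx => ?_)
    simp only [Finset.mem_filter, Finset.mem_product, T] at hx
    obtain ⟨⟨⟨⟨a1, a2⟩, b1, b2⟩, ⟨c1, c2⟩, d1, d2⟩, he⟩ := hx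
    simp only [Finset.mem_filter, Finset.mem_product, mem_sameFiber, D]
    exact ⟨⟨⟨⟨⟨a1, b1⟩, a2.trans b2.symm⟩, ⟨c1, d1⟩, c2.trans d2.symm⟩, he⟩, a2⟩
  refine (Finset.sum_le_sum hk).trans ?_
  have hmap : ∀ x ∈ D, c x.1.1 ∈ S.image c := fun x hx => Finset.mem_image_of_mem c
    (mem_sameFiber.1 (Finset.mem_product.1 (Finset.mem_filter.1 hx).1).1).1.1
  rw [← Nat.cast_sum, ← Finset.card_eq_sum_card_fiberwise hmap]
  exact_mod_cast card_mul_eq_mul_le S (fun F hF => (hS F hF).ne_zero) c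

open Classical in
lemma integral_sq_sum_norm_sq_fiberSum_le (hf : IsSteinhaus f μ) {S : Finset K[X]}
    (hS : ∀ F ∈ S, F.Monic) (c : K[X] → κ) :
    ∫ ω, (∑ k ∈ S.image c, ‖fiberSum f S c k ω‖ ^ 2) ^ 2 ∂μ ≤
      S.card ^ 2 + (sameFiber S c).card + (offDiagonalSolutions S).card := by
  have e : ∀ ω, (∑ k ∈ S.image c, ‖fiberSum f S c k ω‖ ^ 2) ^ 2 =
      ‖∑ x ∈ sameFiber S c, f x.1 ω * starRingEnd ℂ (f x.2 ω)‖ ^ 2 := by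
    intro ω
    have h := sum_fiberSum_bilinear (f := f) S c (fun F => starRingEnd ℂ (f F ω)) ω
    have h2 : ∑ x ∈ sameFiber S c, f x.1 ω * starRingEnd ℂ (f x.2 ω) =
        ((∑ k ∈ S.image c, ‖fiberSum f S c k ω‖ ^ 2 : ℝ) : ℂ) := by
      rw [← h, Complex.ofReal_sum]
      refine Finset.sum_congr rfl fun k _ => ?_
      rw [← map_sum, ← fiberSum.eq_1, Complex.mul_conj, Complex.normSq_eq_norm_sq]
    rw [h2, Complex.norm_real, Real.norm_eq_abs, sq_abs]
  simp_rw [e]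
  rw [integral_norm_sq_sum hf _ (fun x => x.1) (fun x => x.2)
    (fun x hx => hS _ (mem_sameFiber.1 hx).1.1) (fun x hx => hS _ (mem_sameFiber.1 hx).1.2)]
  exact_mod_cast card_mul_eq_mul_le_sq S (fun F hF => (hS F hF).ne_zero) c

open Classical in
lemma sum_integral_norm_sq_fiberSum (hf : IsSteinhaus f μ) {S : Finset K[X]}
    (hS : ∀ F ∈ S, F.Monic) (c : K[X] → κ) :
    ∑ k ∈ S.image c, ∫ ω, ‖fiberSum f S c k ω‖ ^ 2 ∂μ = S.card := by
  have h : ∀ k ∈ S.image c, ∫ ω, ‖fiberSum f S c k ω‖ ^ 2 ∂μ =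
      ((S.filter fun F => c F = k).card : ℝ) := fun k _ =>
    integral_norm_sq_sum_apply hf fun F hF => hS F (Finset.mem_filter.1 hF).1
  rw [Finset.sum_congr rfl h, ← Nat.cast_sum, ← Finset.card_eq_sum_card_fiberwise
    fun F hF => Finset.mem_image_of_mem c hF]

end FiberMoments

/-! ### Existence and ordering of largest primes -/

section LargestPrime

variable {K : Type*} [Field K]

lemma IsDegreeOrder.exists_isLargestPrimeFactor {prec : MonicIrred K → MonicIrred K → Prop}
    (hprec : IsDegreeOrder prec) {F : K[X]} (hF : F.Monic) (hd : F.natDegree ≠ 0) :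
    ∃ Q, IsLargestPrimeFactor prec Q F := by
  classical
  have := hprec.strictTotal
  let : LinearOrder (MonicIrred K) := linearOrderOfSTO prec
  obtain ⟨a, rfl⟩ := hF.exists_ofExponents
  have hne : a.support.Nonempty := by
    rw [Finset.nonempty_iff_ne_empty, Ne, Finsupp.support_eq_empty]
    rintro rfl
    exact hd (by simp [ofExponents])
  obtain ⟨Q, hQ, hmax⟩ := a.support.exists_max_image id hne
  refine ⟨Q, dvd_ofExponents_iff.2 (Finsupp.mem_support_iff.1 hQ), fun P hP => ?_⟩
  exact (hmax P (Finsupp.mem_support_iff.2 (dvd_ofExponents_iff.1 hP))).eq_or_lt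

lemma IsLargestPrimeFactor.not_dvd_of_prec {prec : MonicIrred K → MonicIrred K → Prop}
    (hprec : IsDegreeOrder prec) {Q R : MonicIrred K} {F : K[X]}
    (hR : IsLargestPrimeFactor prec R F) (h : prec R Q) : ¬ (Q : K[X]) ∣ F := by
  have := hprec.strictTotal
  intro hQ
  rcases hR.2 Q hQ with rfl | h'
  · exact irrefl_of prec Q h
  · exact asymm_of prec h h'

end LargestPrime

/-! ### Real projections of the fiber sums -/

section Projection

/-- This rests on `Re(w)² = (|w|² + Re(w²))/2`: the first part carries the variance, the second is
an oscillating error. -/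
lemma sum_re_sq {κ : Type*} (s : Finset κ) (u : ℂ) (Z : κ → ℂ) :
    ∑ k ∈ s, (u * Z k).re ^ 2 =
      ‖u‖ ^ 2 / 2 * ∑ k ∈ s, ‖Z k‖ ^ 2 + (u ^ 2 * ∑ k ∈ s, Z k ^ 2).re / 2 := by
  rw [Finset.mul_sum, Finset.mul_sum, Complex.re_sum, Finset.sum_div, ← Finset.sum_add_distrib]
  refine Finset.sum_congr rfl fun k _ => ?_
  rw [← Complex.normSq_eq_norm_sq, ← Complex.normSq_eq_norm_sq]
  simp only [Complex.normSq_apply, sq, Complex.mul_re, Complex.mul_im]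
  ring

variable {K : Type*} [Field K] {Ω : Type*} {f : K[X] → Ω → ℂ}

lemma measurable_re_fiberSum {m : MeasurableSpace Ω} {S : Finset K[X]} {κ : Type*}
    {c : K[X] → κ} {r : κ} (h : ∀ F ∈ S, c F = r → Measurable (f F)) (u : ℂ) :
    Measurable fun ω => (u * fiberSum f S c r ω).re := by
  classical
  have : Measurable (fiberSum f S c r) := Finset.measurable_fun_sum _ fun F hF =>
    h F (Finset.mem_filter.1 hF).1 (Finset.mem_filter.1 hF).2
  fun_prop

lemma measurable_comp_sum_re_fiberSum {m : MeasurableSpace Ω} {S : Finset K[X]} {κ : Type*}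
    {c : K[X] → κ} {s : Finset κ} (h : ∀ r ∈ s, ∀ F ∈ S, c F = r → Measurable (f F)) (u : ℂ)
    {g : ℝ → ℝ → ℂ} (hg : Continuous (Function.uncurry g)) :
    Measurable fun ω => g (∑ r ∈ s, (u * fiberSum f S c r ω).re)
      (∑ r ∈ s, (u * fiberSum f S c r ω).re ^ 2) := by
  have h1 : Measurable fun ω => ∑ r ∈ s, (u * fiberSum f S c r ω).re :=
    Finset.measurable_fun_sum _ fun r hr => measurable_re_fiberSum (h r hr) u
  have h2 : Measurable fun ω => ∑ r ∈ s, (u * fiberSum f S c r ω).re ^ 2 :=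
    Finset.measurable_fun_sum _ fun r hr => (measurable_re_fiberSum (h r hr) u).pow_const 2
  exact hg.measurable.comp (h1.prodMk h2)

variable [MeasurableSpace Ω] {μ : Measure Ω} [IsProbabilityMeasure μ]

open Classical in
/-- The martingale difference property of the fiber sums over the largest prime factor. -/
lemma integral_re_fiberSum_mul_eq_zero (hf : IsSteinhaus f μ) {S : Finset K[X]}
    (hS : ∀ F ∈ S, F.Monic) {κ : Type*} {c : K[X] → κ} {k : κ} {Q : MonicIrred K}
    (hQ : ∀ F ∈ S, c F = k → (Q : K[X]) ∣ F) (u : ℂ) {Y : Ω → ℂ}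
    (hY : Measurable[sigmaAway f Q] Y) {M : ℝ} (hM : ∀ ω, ‖Y ω‖ ≤ M) :
    ∫ ω, ((u * fiberSum f S c k ω).re : ℂ) * Y ω ∂μ = 0 := by
  set T := S.filter fun F => c F = k
  have hT : ∀ F ∈ T, F.Monic := fun F hF => hS F (Finset.mem_filter.1 hF).1
  have hTQ : ∀ F ∈ T, (Q : K[X]) ∣ F := fun F hF =>
    hQ F (Finset.mem_filter.1 hF).1 (Finset.mem_filter.1 hF).2
  have hYi : Integrable Y μ := Integrable.of_bound
    (hY.mono (hf.sigmaAway_le Q) le_rfl).aestronglyMeasurable M (Eventually.of_forall hM)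
  have hi1 : ∀ F ∈ T, Integrable (fun ω => f F ω * Y ω) μ := fun F hF => by
    refine hYi.bdd_mul (c := 1) (hf.measurable (hT F hF)).aestronglyMeasurable ?_
    filter_upwards [hf.norm_ae (hT F hF)] with ω hω using hω.le
  have hi2 : ∀ F ∈ T, Integrable (fun ω => starRingEnd ℂ (f F ω) * Y ω) μ := fun F hF => by
    have := hf.measurable (hT F hF)
    refine hYi.bdd_mul (c := 1) (by fun_prop) ?_
    filter_upwards [hf.norm_ae (hT F hF)] with ω hω
    rw [RCLike.norm_conj, hω]
  have e : ∀ ω, ((u * fiberSum f S c k ω).re : ℂ) * Y ω =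
      u / 2 * ∑ F ∈ T, f F ω * Y ω +
        starRingEnd ℂ u / 2 * ∑ F ∈ T, starRingEnd ℂ (f F ω) * Y ω := by
    intro ω
    rw [Complex.re_eq_add_conj, map_mul, ← Finset.sum_mul, ← Finset.sum_mul, ← map_sum]
    change (u * fiberSum f S c k ω + _) / 2 * Y ω = u / 2 * (fiberSum f S c k ω * Y ω) +
      starRingEnd ℂ u / 2 * (starRingEnd ℂ (fiberSum f S c k ω) * Y ω)
    ring
  simp_rw [e]
  rw [integral_add ((integrable_finsetSum _ hi1).const_mul _)
    ((integrable_finsetSum _ hi2).const_mul _), integral_const_mul, integral_const_mul,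
    integral_finsetSum _ hi1, integral_finsetSum _ hi2,
    Finset.sum_eq_zero fun F hF => hf.integral_mul_eq_zero (hT F hF) (hTQ F hF) hY,
    Finset.sum_eq_zero fun F hF => hf.integral_conj_mul_eq_zero (hT F hF) (hTQ F hF) hY]
  simp

open Classical in
lemma sum_integral_re_fiberSum_pow_four_le (hf : IsSteinhaus f μ) {S : Finset K[X]}
    (hS : ∀ F ∈ S, F.Monic) {κ : Type*} (c : K[X] → κ) (u : ℂ) :
    ∑ k ∈ S.image c, ∫ ω, (u * fiberSum f S c k ω).re ^ 4 ∂μ ≤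
      ‖u‖ ^ 4 * (2 * (sameFiber S c).card + (offDiagonalSolutions S).card) := by
  refine le_trans ?_ (mul_le_mul_of_nonneg_left
    (sum_integral_norm_fiberSum_pow_four_le hf hS c) (by positivity))
  rw [Finset.mul_sum]
  refine Finset.sum_le_sum fun k _ => ?_
  rw [← integral_const_mul]
  have hm := measurable_fiberSum hf hS c k
  refine integral_mono_of_nonneg (Eventually.of_forall fun ω => ?_) ?_
    (Eventually.of_forall fun ω => ?_)
  · exact Even.pow_nonneg (by decide) _
  · refine Integrable.const_mul (Integrable.of_bound (by fun_prop) ((S.card : ℝ) ^ 4) ?_) _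
    filter_upwards [ae_norm_fiberSum_le hf hS c k] with ω hω
    rw [norm_pow, norm_norm]
    gcongr
  · simp only
    rw [← Even.pow_abs (by decide : Even 4), ← mul_pow, ← norm_mul]
    gcongr
    exact Complex.abs_re_le_norm _

-- With `W = ∑ |Z|²` and `V = ∑ Z²`, the deviation is `(|u|²(W - n) + Re(u²V))/2`. Since `W` has
-- mean `|S|`, the second-moment bound leaves `(n - |S|)²` plus small counts for `W - n`; `V` has
-- small counts only. A factor `1/2` is discarded at the end.
open Classical in
lemma integral_sq_sum_re_fiberSum_sq_sub_le (hf : IsSteinhaus f μ) {S : Finset K[X]}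
    (hS : ∀ F ∈ S, F.Monic) {κ : Type*} (c : K[X] → κ) (u : ℂ) (n : ℝ) :
    ∫ ω, (∑ k ∈ S.image c, (u * fiberSum f S c k ω).re ^ 2 - ‖u‖ ^ 2 / 2 * n) ^ 2 ∂μ ≤
      ‖u‖ ^ 4 * ((n - S.card) ^ 2 + 3 * (sameFiber S c).card +
        2 * (offDiagonalSolutions S).card) := by
  set W : Ω → ℝ := fun ω => ∑ k ∈ S.image c, ‖fiberSum f S c k ω‖ ^ 2 with hW
  set V : Ω → ℂ := fun ω => ∑ k ∈ S.image c, fiberSum f S c k ω ^ 2 with hV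
  have hm := fun k => measurable_fiberSum hf hS c k
  have hWm : Measurable W :=
    Finset.measurable_fun_sum _ fun k _ => (hm k).norm.pow_const 2
  have hVm : Measurable V := Finset.measurable_fun_sum _ fun k _ => (hm k).pow_const 2
  have hall : ∀ᵐ ω ∂μ, ∀ k ∈ S.image c, ‖fiberSum f S c k ω‖ ≤ S.card :=
    (ae_ball_iff (S.image c).countable_toSet).2 fun k _ => ae_norm_fiberSum_le hf hS c k
  have hWb : ∀ᵐ ω ∂μ, W ω ≤ (S.image c).card * (S.card : ℝ) ^ 2 := by
    filter_upwards [hall] with ω hω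
    rw [← nsmul_eq_mul]
    exact Finset.sum_le_card_nsmul _ _ _ fun k hk => by gcongr; exact hω k hk
  have hW0 : ∀ ω, 0 ≤ W ω := fun ω => Finset.sum_nonneg fun k _ => by positivity
  have hVW : ∀ ω, ‖V ω‖ ≤ W ω := fun ω =>
    (norm_sum_le _ _).trans (Finset.sum_le_sum fun k _ => (norm_pow _ _).le)
  have hWi : Integrable W μ := by
    refine Integrable.of_bound hWm.aestronglyMeasurable ((S.image c).card * (S.card : ℝ) ^ 2) ?_
    filter_upwards [hWb] with ω hω
    rwa [Real.norm_eq_abs, abs_of_nonneg (hW0 ω)]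
  have hW2i : Integrable (fun ω => W ω ^ 2) μ := by
    refine Integrable.of_bound (hWm.pow_const 2).aestronglyMeasurable
      (((S.image c).card * (S.card : ℝ) ^ 2) ^ 2) ?_
    filter_upwards [hWb] with ω hω
    rw [norm_pow, Real.norm_eq_abs, abs_of_nonneg (hW0 ω)]
    gcongr
  have hV2i : Integrable (fun ω => ‖V ω‖ ^ 2) μ := by
    refine hW2i.mono' (hVm.norm.pow_const 2).aestronglyMeasurable (Eventually.of_forall fun ω => ?_)
    rw [norm_pow, norm_norm]
    gcongr
    exact hVW ω
  have hEW : ∫ ω, W ω ∂μ = S.card := by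
    rw [hW, integral_finsetSum]
    · exact sum_integral_norm_sq_fiberSum hf hS c
    · intro k _
      have := hm k
      refine Integrable.of_bound (by fun_prop) ((S.card : ℝ) ^ 2) ?_
      filter_upwards [ae_norm_fiberSum_le hf hS c k] with ω hω
      rw [norm_pow, norm_norm]
      gcongr
  have hEWn : ∫ ω, (W ω - n) ^ 2 ∂μ ≤
      (n - S.card) ^ 2 + (sameFiber S c).card + (offDiagonalSolutions S).card := by
    have e : ∀ ω, (W ω - n) ^ 2 = W ω ^ 2 + (-(2 * n) * W ω + n ^ 2) := fun ω => by ring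
    simp_rw [e]
    have hlin : Integrable (fun ω => -(2 * n) * W ω + n ^ 2) μ :=
      (hWi.const_mul _).add (integrable_const _)
    rw [integral_add hW2i hlin, integral_add (hWi.const_mul _) (integrable_const _), integral_const_mul, hEW]
    simp only [integral_const, probReal_univ, smul_eq_mul, one_mul]
    have : ∫ ω, W ω ^ 2 ∂μ ≤ _ := integral_sq_sum_norm_sq_fiberSum_le hf hS c
    nlinarith
  have hEWi : Integrable (fun ω => (W ω - n) ^ 2) μ := by
    have e : ∀ ω, (W ω - n) ^ 2 = W ω ^ 2 + (-(2 * n) * W ω + n ^ 2) := fun ω => by ring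
    simp_rw [e]
    exact hW2i.add ((hWi.const_mul _).add (integrable_const _))
  have hEV := integral_norm_sq_sum_fiberSum_sq_le hf hS c
  calc _ ≤ ∫ ω, ‖u‖ ^ 4 / 2 * ((W ω - n) ^ 2 + ‖V ω‖ ^ 2) ∂μ := by
        refine integral_mono_of_nonneg (Eventually.of_forall fun ω => sq_nonneg _)
          ((hEWi.add hV2i).const_mul _) (Eventually.of_forall fun ω => ?_)
        simp only
        rw [sum_re_sq]
        have h1 : |(u ^ 2 * V ω).re| ≤ ‖u‖ ^ 2 * ‖V ω‖ := by
          rw [← norm_pow, ← norm_mul]; exact Complex.abs_re_le_norm _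
        have h2 : (u ^ 2 * V ω).re ^ 2 ≤ (‖u‖ ^ 2 * ‖V ω‖) ^ 2 := by
          rw [← sq_abs]; gcongr
        change (‖u‖ ^ 2 / 2 * W ω + (u ^ 2 * V ω).re / 2 - ‖u‖ ^ 2 / 2 * n) ^ 2 ≤ _
        nlinarith [sq_nonneg (‖u‖ ^ 2 * (W ω - n) - (u ^ 2 * V ω).re)]
    _ = ‖u‖ ^ 4 / 2 * (∫ ω, (W ω - n) ^ 2 ∂μ + ∫ ω, ‖V ω‖ ^ 2 ∂μ) := by
        rw [integral_const_mul, integral_add hEWi hV2i]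
    _ ≤ ‖u‖ ^ 4 / 2 * (((n - S.card) ^ 2 + (sameFiber S c).card + (offDiagonalSolutions S).card) +
          (2 * (sameFiber S c).card + (offDiagonalSolutions S).card)) := by gcongr
    _ ≤ _ := by
        have : (0 : ℝ) ≤ ‖u‖ ^ 4 * ((n - S.card) ^ 2 + 3 * (sameFiber S c).card +
          2 * (offDiagonalSolutions S).card) := by positivity
        linarith

end Projection

/-! ### Characteristic functions and Lévy's theorem -/

section CharFun

lemma re_mul_conj_eq (t z : ℂ) : (t * starRingEnd ℂ z).re = (starRingEnd ℂ t * z).re := by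
  simp [Complex.mul_re]

lemma charFun_stdComplexNormal (t : ℂ) :
    charFun stdComplexNormal t = Real.exp (-(‖t‖ ^ 2 / 2 / 2)) := by
  rw [charFun_apply, stdComplexNormal, integral_map
    Complex.measurableEquivRealProd.symm.measurable.aemeasurable (by fun_prop)]
  have e : ∀ p : ℝ × ℝ,
      Complex.exp ((inner ℝ (Complex.measurableEquivRealProd.symm p) t : ℝ) * Complex.I) =
        Complex.exp (t.re * p.1 * Complex.I) * Complex.exp (t.im * p.2 * Complex.I) := by
    intro p
    rw [Complex.measurableEquivRealProd_symm_apply, Complex.inner, re_mul_conj_eq,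
      ← Complex.exp_add]
    congr 1
    simp only [Complex.mul_re, Complex.conj_re, Complex.conj_im]
    push_cast
    ring
  simp_rw [e]
  rw [integral_prod_mul (fun x : ℝ => Complex.exp (t.re * x * Complex.I))
    (fun y : ℝ => Complex.exp (t.im * y * Complex.I)), ← charFun_apply_real, ← charFun_apply_real,
    charFun_gaussianReal, charFun_gaussianReal, ← Complex.exp_add, ← Complex.normSq_eq_norm_sq,
    Complex.normSq_apply, Complex.ofReal_exp]
  congr 1
  push_cast
  ring

lemma norm_cexp_I_sub_le (a b : ℝ) :
    ‖Complex.exp (Complex.I * a) - Complex.exp (Complex.I * b)‖ ≤ |a - b| := by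
  have h : Complex.exp (Complex.I * a) - Complex.exp (Complex.I * b) =
      Complex.exp (Complex.I * b) * (Complex.exp (Complex.I * (a - b : ℝ)) - 1) := by
    rw [mul_sub, ← Complex.exp_add, mul_one]
    congr 2
    push_cast
    ring
  rw [h, norm_mul, mul_comm Complex.I (b : ℂ), Complex.norm_exp_ofReal_mul_I, one_mul]
  exact Real.norm_exp_I_mul_ofReal_sub_one_le

/-- **Lévy's convergence theorem** along a countably generated filter. -/
lemma tendsto_probabilityMeasure_of_tendsto_charFun {ι E : Type*} [NormedAddCommGroup E]
    [InnerProductSpace ℝ E] [FiniteDimensional ℝ E] [MeasurableSpace E] [BorelSpace E]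
    {l : Filter ι} [l.IsCountablyGenerated] {ν : ι → ProbabilityMeasure E}
    {ν₀ : ProbabilityMeasure E}
    (h : ∀ t : E, Tendsto (fun i => charFun (ν i) t) l (nhds (charFun ν₀ t))) :
    Tendsto ν l (nhds ν₀) :=
  tendsto_of_seq_tendsto fun _ hx =>
    ProbabilityMeasure.tendsto_of_tendsto_charFun fun t => (h t).comp hx

end CharFun

/-! ### Quantitative central limit theorem for Steinhaus sums -/

section Steinhaus

universe u w

/-- Quantitative central limit theorem for Steinhaus sums, for a fixed frequency `t`. -/
theorem exists_norm_integral_steinhaus_sub_le (t : ℂ) :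
    ∃ M : ℝ, 0 ≤ M ∧ ∀ {K : Type u} [Field K] {Ω : Type w} [MeasurableSpace Ω]
      {f : K[X] → Ω → ℂ} {μ : Measure Ω} [IsProbabilityMeasure μ], IsSteinhaus f μ →
      ∀ {prec : MonicIrred K → MonicIrred K → Prop}, IsDegreeOrder prec →
      ∀ {A S : Finset K[X]}, (∀ F ∈ A, F.Monic) → (∀ F ∈ A, F.natDegree ≠ 0) → S ⊆ A →
      A.Nonempty → ∀ {m δ : ℝ}, (∀ Q, ((withLargestPrime prec S Q).card : ℝ) ≤ m * A.card) →
      0 < δ → δ ≤ 1 →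
      ‖t‖ ^ 4 * (((setDifference A S).card / A.card : ℝ) ^ 2 + 3 * m +
        2 * ((offDiagonalSolutions S).card / (A.card : ℝ) ^ 2)) ≤ δ ^ 2 →
      ‖t‖ ^ 2 * ((setDifference A S).card / A.card : ℝ) ≤ δ ^ 2 →
      ‖∫ ω, Complex.exp (Complex.I * ((starRingEnd ℂ t *
          (((Real.sqrt (A.card : ℝ) : ℝ) : ℂ)⁻¹ * ∑ F ∈ A, f F ω)).re : ℝ)) ∂μ -
        Real.exp (-(‖t‖ ^ 2 / 2 / 2))‖ ≤ M * δ := by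
  obtain ⟨M, hM, hmain⟩ := exists_norm_charFun_martingale_sub_le.{w, u} (‖t‖ ^ 2 / 2)
    (by positivity)
  refine ⟨1 + M, by positivity, ?_⟩
  intro K _ Ω _ f μ _ hf prec hprec A S hA hdeg hSA hne m δ hm hδ hδ1 h4 h2
  classical
  have : IsStrictTotalOrder (MonicIrred K) prec := hprec.strictTotal
  let : LinearOrder (MonicIrred K) := linearOrderOfSTO prec
  have : Nonempty (MonicIrred K) := ⟨⟨X, monic_X, irreducible_X⟩⟩
  have hS : ∀ F ∈ S, F.Monic := fun F hF => hA F (hSA hF)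
  have hex : ∀ F, F ∈ S → ∃ Q, IsLargestPrimeFactor prec Q F := fun F hF =>
    hprec.exists_isLargestPrimeFactor (hS F hF) (hdeg F (hSA hF))
  -- Outside `S` the value of `c` is arbitrary; fibers are only ever formed inside `S`.
  choose! c hc using hex
  set n : ℝ := (A.card : ℝ) with hn
  have hn0 : 0 < n := Nat.cast_pos.2 hne.card_pos
  set v : ℂ := starRingEnd ℂ t * ((Real.sqrt n : ℝ) : ℂ)⁻¹ with hv
  have hv2 : ‖v‖ ^ 2 = ‖t‖ ^ 2 / n := by
    rw [hv, norm_mul, RCLike.norm_conj, norm_inv, Complex.norm_real, mul_pow, inv_pow,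
      Real.norm_eq_abs, sq_abs, Real.sq_sqrt hn0.le, div_eq_mul_inv]
  have hv4 : ‖v‖ ^ 4 = ‖t‖ ^ 4 / n ^ 2 := by
    rw [show ‖v‖ ^ 4 = (‖v‖ ^ 2) ^ 2 by ring, hv2]; ring
  have hSn : (S.card : ℝ) ≤ n := Nat.cast_le.2 (Finset.card_le_card hSA)
  have hm0 : 0 ≤ m := by
    have h := (Nat.cast_nonneg (α := ℝ) _).trans (hm (Classical.arbitrary _))
    exact nonneg_of_mul_nonneg_left h hn0
  have hdiff : ((setDifference A S).card : ℝ) = n - S.card := by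
    have : (setDifference A S).card + S.card = A.card := Finset.card_sdiff_add_card_eq_card hSA
    rw [eq_sub_iff_add_eq, hn]; exact_mod_cast this
  set d : ℝ := ((setDifference A S).card : ℝ) with hd
  have hd0 : 0 ≤ d := Nat.cast_nonneg _
  set o : ℝ := ((offDiagonalSolutions S).card : ℝ) with ho
  have ho0 : 0 ≤ o := Nat.cast_nonneg _
  have hJ : ((sameFiber S c).card : ℝ) ≤ m * n ^ 2 := by
    have h := card_sameFiber_le S c (m := m * n) fun Q => by
      refine le_trans (Nat.cast_le.2 (Finset.card_le_card fun F hF => ?_)) (hm Q)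
      simp only [Finset.mem_filter] at hF
      obtain ⟨h1, rfl⟩ := hF
      exact Finset.mem_filter.2 ⟨h1, hc F h1⟩
    calc _ ≤ S.card * (m * n) := h
      _ ≤ n * (m * n) := by gcongr
      _ = _ := by ring
  have hS4 := sum_integral_re_fiberSum_pow_four_le hf hS c v
  have hS2 := integral_sq_sum_re_fiberSum_sq_sub_le hf hS c v n
  have hkey : ‖v‖ ^ 4 * (d ^ 2 + 3 * (sameFiber S c).card + 2 * o) ≤ δ ^ 2 := by
    refine le_trans ?_ h4
    rw [hv4]
    calc _ ≤ ‖t‖ ^ 4 / n ^ 2 * (d ^ 2 + 3 * (m * n ^ 2) + 2 * o) := by gcongr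
      _ = _ := by field_simp
  have hmart := hmain μ (fun Q ω => (v * fiberSum f S c Q ω).re) (‖v‖ * S.card)
    (fun Q => measurable_re_fiberSum (fun F hF _ => hf.measurable (hS F hF)) v)
    (fun Q => by
      filter_upwards [ae_norm_fiberSum_le hf hS c Q] with ω hω
      refine (Complex.abs_re_le_norm _).trans ?_
      rw [norm_mul]
      gcongr)
    (fun Q s hs g hg ⟨B, hB⟩ => by
      refine integral_re_fiberSum_mul_eq_zero hf hS (fun F hF h => h ▸ (hc F hF).1) v ?_
        fun ω => hB _ _
      refine @measurable_comp_sum_re_fiberSum K _ Ω f (sigmaAway f Q) S _ c s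
        (fun r hr F hF h => ?_) v g hg
      refine hf.measurable_sigmaAway (hS F hF) ?_
      subst h
      -- An `F` in an earlier fiber has all its primes below `Q`, so the past is a function of the
      -- primes other than `Q`.
      exact (hc F hF).not_dvd_of_prec hprec (hs _ hr))
    _ δ hδ hδ1
    -- The fourth-moment count `2J + o` is dominated by the `d² + 3J + 2o` of the variance bound, so
    -- one hypothesis controls both.
    (hS4.trans (le_trans (mul_le_mul_of_nonneg_left (by
      linarith [sq_nonneg d, Nat.cast_nonneg (α := ℝ) (sameFiber S c).card])
      (by positivity)) hkey))
    (by
      rw [show ‖v‖ ^ 2 / 2 * n = ‖t‖ ^ 2 / 2 by rw [hv2]; field_simp, ← hdiff] at hS2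
      exact hS2.trans hkey)
  -- `R` is the contribution of `A ∖ S`; by orthogonality its second moment is at most `‖t‖² d / n`.
  set R : Ω → ℝ := fun ω => (v * ∑ F ∈ setDifference A S, f F ω).re with hR
  have hD : ∀ F ∈ setDifference A S, F.Monic := fun F hF => hA F (Finset.mem_sdiff.1 hF).1
  have hDm := measurable_sum_apply hf hD
  have hSm := measurable_sum_apply hf hS
  have hAm := measurable_sum_apply hf hA
  have hRm : Measurable R := by fun_prop
  have hRb : ∀ᵐ ω ∂μ, |R ω| ≤ ‖v‖ * d := by
    filter_upwards [ae_norm_sum_le hf hD] with ω hω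
    refine (Complex.abs_re_le_norm _).trans ?_
    rw [norm_mul]
    gcongr
  have hRi : Integrable R μ := Integrable.of_bound hRm.aestronglyMeasurable _ hRb
  have hR2i : Integrable (fun ω => R ω ^ 2) μ := by
    refine Integrable.of_bound (hRm.pow_const 2).aestronglyMeasurable ((‖v‖ * d) ^ 2) ?_
    filter_upwards [hRb] with ω hω
    rw [norm_pow, Real.norm_eq_abs]
    gcongr
  have hR2 : ∫ ω, R ω ^ 2 ∂μ ≤ δ ^ 2 := by
    refine le_trans ?_ h2
    calc _ ≤ ∫ ω, ‖v‖ ^ 2 * ‖∑ F ∈ setDifference A S, f F ω‖ ^ 2 ∂μ := by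
          refine integral_mono_of_nonneg (Eventually.of_forall fun ω => sq_nonneg _) ?_
            (Eventually.of_forall fun ω => ?_)
          · refine Integrable.const_mul (Integrable.of_bound
              (hDm.norm.pow_const 2).aestronglyMeasurable (d ^ 2) ?_) _
            filter_upwards [ae_norm_sum_le hf hD] with ω hω
            rw [norm_pow, norm_norm]
            gcongr
          · simp only
            rw [← sq_abs, ← mul_pow, ← norm_mul]
            gcongr
            exact Complex.abs_re_le_norm _
      _ = ‖v‖ ^ 2 * d := by rw [integral_const_mul, integral_norm_sq_sum_apply hf hD]
      _ = _ := by rw [hv2]; ring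
  have hR1 : ∫ ω, |R ω| ∂μ ≤ δ := integral_abs_le_of_integral_sq_le μ hδ hRi hR2i hR2
  have hsumS : ∀ ω, ∑ Q ∈ S.image c, (v * fiberSum f S c Q ω).re = (v * ∑ F ∈ S, f F ω).re := by
    intro ω
    rw [← Complex.re_sum, ← Finset.mul_sum]
    congr 2
    convert sum_fiberSum (f := f) S c ω
  have hsumA : ∀ ω, (starRingEnd ℂ t * (((Real.sqrt n : ℝ) : ℂ)⁻¹ * ∑ F ∈ A, f F ω)).re =
      (v * ∑ F ∈ A, f F ω).re := fun ω => by rw [hv, mul_assoc]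
  have hsub : ∀ ω, (v * ∑ F ∈ A, f F ω).re - (v * ∑ F ∈ S, f F ω).re = R ω := fun ω => by
    rw [hR, ← Finset.sum_sdiff hSA, mul_add, Complex.add_re, add_sub_cancel_right]
    rfl
  have hexpi : ∀ x : Ω → ℝ, Measurable x →
      Integrable (fun ω => Complex.exp (Complex.I * (x ω : ℂ))) μ := fun x hx => by
    refine Integrable.of_bound (by fun_prop) 1 (Eventually.of_forall fun ω => ?_)
    rw [mul_comm, Complex.norm_exp_ofReal_mul_I]
  simp_rw [hsumA]
  have hfirst : ‖∫ ω, Complex.exp (Complex.I * ((v * ∑ F ∈ A, f F ω).re : ℝ)) ∂μ -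
      ∫ ω, Complex.exp (Complex.I * ((v * ∑ F ∈ S, f F ω).re : ℝ)) ∂μ‖ ≤ δ := by
    rw [← integral_sub (hexpi _ (by fun_prop)) (hexpi _ (by fun_prop))]
    refine (norm_integral_le_of_norm_le hRi.abs (Eventually.of_forall fun ω => ?_)).trans hR1
    rw [← hsub ω]
    exact norm_cexp_I_sub_le _ _
  have hsecond : ‖∫ ω, Complex.exp (Complex.I * ((v * ∑ F ∈ S, f F ω).re : ℝ)) ∂μ -
      Real.exp (-(‖t‖ ^ 2 / 2 / 2))‖ ≤ M * δ := by
    simp_rw [← hsumS]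
    convert hmart
  calc _ ≤ _ := norm_sub_le_norm_sub_add_norm_sub _ _ _
    _ ≤ δ + M * δ := add_le_add hfirst hsecond
    _ = _ := by ring

end Steinhaus

/-! ### The uniform condition (iii) as a single real parameter -/

section LargestPrimeRatio

variable {K : Type*} [Field K]

/-- The largest proportion of `A` taken by the elements of `S` with a given largest prime. -/
noncomputable def maxLargestPrimeRatio (prec : MonicIrred K → MonicIrred K → Prop)
    (A S : Finset K[X]) : ℝ :=
  ⨆ Q, ((withLargestPrime prec S Q).card : ℝ) / A.card

lemma maxLargestPrimeRatio_nonneg (prec : MonicIrred K → MonicIrred K → Prop)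
    (A S : Finset K[X]) : 0 ≤ maxLargestPrimeRatio prec A S :=
  Real.iSup_nonneg fun _ => by positivity

lemma card_withLargestPrime_le (prec : MonicIrred K → MonicIrred K → Prop)
    {A : Finset K[X]} (S : Finset K[X]) (hA : A.Nonempty) (Q : MonicIrred K) :
    ((withLargestPrime prec S Q).card : ℝ) ≤ maxLargestPrimeRatio prec A S * A.card := by
  have hA0 : (0 : ℝ) < A.card := Nat.cast_pos.2 hA.card_pos
  rw [← div_le_iff₀ hA0]
  -- A real supremum is meaningful only for a bounded family; `|S|/|A|` is a bound here.
  refine le_ciSup (f := fun Q => ((withLargestPrime prec S Q).card : ℝ) / A.card)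
    ⟨(S.card : ℝ) / A.card, ?_⟩ Q
  rintro _ ⟨R, rfl⟩
  dsimp only
  gcongr
  classical exact Finset.filter_subset _ _

end LargestPrimeRatio

/-! ### The limit theorem -/

/-- The limit `q ^ N → ∞` is taken along an arbitrary filter `l` on an arbitrary index set of
parameters `i`, each with its finite field `K i` of `q` elements and its degree `N i`. -/
theorem mainTheorem2 {ι : Type*} (l : Filter ι)
    (K : ι → Type*) [∀ i, Field (K i)] [∀ i, Finite (K i)] (N : ι → ℕ)
    (hqN : Tendsto (fun i => Nat.card (K i) ^ N i) l atTop)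
    (prec : ∀ i, MonicIrred (K i) → MonicIrred (K i) → Prop)
    (hprec : ∀ i, IsDegreeOrder (prec i))
    (A S : ∀ i, Finset (K i)[X])
    (hA : ∀ i, ∀ F ∈ A i, F.Monic ∧ F.natDegree = N i)
    (hA_nonempty : ∀ᶠ i in l, (A i).Nonempty)
    (hSA : ∀ i, S i ⊆ A i)
    (h_diff : (fun i => ((setDifference (A i) (S i)).card : ℝ)) =o[l]
      (fun i => ((A i).card : ℝ)))
    (h_offdiag : (fun i => ((offDiagonalSolutions (S i)).card : ℝ)) =o[l]
      (fun i => ((A i).card : ℝ) ^ 2))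
    (h_largest : ∀ ε : ℝ, 0 < ε → ∀ᶠ i in l, ∀ Q : MonicIrred (K i),
      ((withLargestPrime (prec i) (S i) Q).card : ℝ) ≤ ε * ((A i).card : ℝ))
    {Ω : ι → Type*} [∀ i, MeasurableSpace (Ω i)] (μ : ∀ i, Measure (Ω i))
    [∀ i, IsProbabilityMeasure (μ i)]
    (f : ∀ i, (K i)[X] → Ω i → ℂ) (hf : ∀ i, IsSteinhaus (f i) (μ i)) :
    TendstoInDistribution
      (fun i ω => ((Real.sqrt ((A i).card : ℝ) : ℝ) : ℂ)⁻¹ * ∑ F ∈ A i, f i F ω)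
      l (id : ℂ → ℂ) μ stdComplexNormal := by
  have hmeas : ∀ i, Measurable
      (fun ω => ((Real.sqrt ((A i).card : ℝ) : ℝ) : ℂ)⁻¹ * ∑ F ∈ A i, f i F ω) := fun i =>
    (measurable_sum_apply (hf i) fun F hF => (hA i F hF).1).const_mul _
  set d : ι → ℝ := fun i => ((setDifference (A i) (S i)).card : ℝ) / (A i).card with hd
  set o : ι → ℝ := fun i => ((offDiagonalSolutions (S i)).card : ℝ) / ((A i).card : ℝ) ^ 2 with ho
  set m : ι → ℝ := fun i => maxLargestPrimeRatio (prec i) (A i) (S i) with hm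
  have hd0 : Tendsto d l (nhds 0) := h_diff.tendsto_div_nhds_zero
  have ho0 : Tendsto o l (nhds 0) := h_offdiag.tendsto_div_nhds_zero
  have hm0 : Tendsto m l (nhds 0) := by
    rw [Metric.tendsto_nhds]
    intro ε hε
    filter_upwards [h_largest (ε / 2) (by positivity), hA_nonempty] with i hi hne
    have hA0 : (0 : ℝ) < (A i).card := Nat.cast_pos.2 hne.card_pos
    rw [Real.dist_eq, sub_zero, abs_of_nonneg (maxLargestPrimeRatio_nonneg _ _ _)]
    refine lt_of_le_of_lt (Real.iSup_le (fun Q => ?_) (by positivity)) (half_lt_self hε)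
    rw [div_le_iff₀ hA0]
    exact hi Q
  -- Degree zero would give `q ^ N = 1`; positive degree ensures that a largest prime factor exists.
  have hN : ∀ᶠ i in l, N i ≠ 0 := by
    filter_upwards [hqN.eventually_gt_atTop 1] with i hi h0
    simp [h0] at hi
  -- A countably generated filter coarser than `l`, for which Lévy's theorem is available.
  set l' : Filter ι := comap (fun i => (d i, o i, m i)) (nhds 0) ⊓
    𝓟 {i | (A i).Nonempty ∧ N i ≠ 0} with hl'
  have hle : l ≤ l' := le_inf
    (tendsto_iff_comap.1 (hd0.prodMk_nhds (ho0.prodMk_nhds hm0)))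
    (le_principal_iff.2 (hA_nonempty.and hN))
  have hlim : Tendsto (fun i => (d i, o i, m i)) l' (nhds 0) := tendsto_comap.mono_left inf_le_left
  have hd' : Tendsto d l' (nhds 0) := (continuous_fst.tendsto _).comp hlim
  have ho' : Tendsto o l' (nhds 0) :=
    ((continuous_fst.comp continuous_snd).tendsto _).comp hlim
  have hm' : Tendsto m l' (nhds 0) :=
    ((continuous_snd.comp continuous_snd).tendsto _).comp hlim
  have hgood : ∀ᶠ i in l', (A i).Nonempty ∧ N i ≠ 0 :=
    (inf_le_right : l' ≤ _) (mem_principal_self _)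
  refine ⟨fun i => (hmeas i).aemeasurable, aemeasurable_id, Tendsto.mono_left ?_ hle⟩
  refine tendsto_probabilityMeasure_of_tendsto_charFun fun t => ?_
  have hcf : ∀ i, charFun ((μ i).map
      (fun ω => ((Real.sqrt ((A i).card : ℝ) : ℝ) : ℂ)⁻¹ * ∑ F ∈ A i, f i F ω)) t =
      ∫ ω, Complex.exp (Complex.I * ((starRingEnd ℂ t *
          (((Real.sqrt ((A i).card : ℝ) : ℝ) : ℂ)⁻¹ * ∑ F ∈ A i, f i F ω)).re : ℝ)) ∂μ i := by
    intro i
    rw [charFun_apply, integral_map (hmeas i).aemeasurable (by fun_prop)]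
    simp_rw [Complex.inner, re_mul_conj_eq, mul_comm _ Complex.I]
  have hcf0 : charFun (stdComplexNormal.map id) t = Real.exp (-(‖t‖ ^ 2 / 2 / 2)) := by
    rw [Measure.map_id, charFun_stdComplexNormal]
  simp only [ProbabilityMeasure.coe_mk]
  rw [hcf0]
  simp_rw [hcf]
  obtain ⟨M, hM, hbound⟩ := exists_norm_integral_steinhaus_sub_le t
  rw [Metric.tendsto_nhds]
  intro ε hε
  -- The cap at one is required by the quantitative bound; `M + 1` in place of `M` avoids division
  -- by zero.
  set δ : ℝ := min 1 (ε / (2 * (M + 1))) with hδ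
  have hδ0 : 0 < δ := by positivity
  have hδε : M * δ < ε := by
    have : (M + 1) * δ ≤ ε / 2 := by
      calc (M + 1) * δ ≤ (M + 1) * (ε / (2 * (M + 1))) := by gcongr; exact min_le_right _ _
        _ = ε / 2 := by field_simp
    nlinarith
  have h4 : Tendsto (fun i => ‖t‖ ^ 4 * (d i ^ 2 + 3 * m i + 2 * o i)) l' (nhds 0) := by
    simpa using (((hd'.pow 2).add (hm'.const_mul 3)).add (ho'.const_mul 2)).const_mul (‖t‖ ^ 4)
  have h2 : Tendsto (fun i => ‖t‖ ^ 2 * d i) l' (nhds 0) := by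
    simpa using hd'.const_mul (‖t‖ ^ 2)
  filter_upwards [hgood, h4.eventually_le_const (by positivity : (0 : ℝ) < δ ^ 2),
    h2.eventually_le_const (by positivity : (0 : ℝ) < δ ^ 2)] with i hi hi4 hi2
  rw [dist_eq_norm]
  refine lt_of_le_of_lt ?_ hδε
  exact hbound (hf i) (hprec i) (fun F hF => (hA i F hF).1)
    (fun F hF => (hA i F hF).2.trans_ne hi.2) (hSA i) hi.1
    (card_withLargestPrime_le (prec i) (S i) hi.1) hδ0 (min_le_left _ _) hi4 hi2
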